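/- Theorem 3.3. Let $\mathbb{F}$ be a field with $\mathrm{char}(\mathbb{F})\neq 2,3$. For a finite group $G$ and a finite dimensional $G$-module $V$ over $\mathbb{F}$, let $\mathbb{F}[V]$ be the symmetric algebra of $V^*$ with its usual grading and with the action of $G$ by graded algebra automorphisms that is induced by $x^g(v)=x(gv)$ ($x\in V^*$, $g\in G$, $v\in V$), let $R=\mathbb{F}[V]^G$ be the ring of invariants, let $R_+$ be its ideal spanned by the homogeneous invariants of positive degree, and let $R_+^k$ be the $\mathbb{F}$-span of the products of $k$ elements of $R_+$. Let $\beta(G,V)$ be the least $s\in\mathbb{N}$ such that $R_+$ is generated as an $R$-module by its elements of degree at most $s$, and for $k\ge 1$ let $\beta_k(G,V)$ be the least $s\in\mathbb{N}$ such that $R_+$ is generated as a module over the non-unital ring $R_+^k$ by its elements of degree at most $s$, that is, such that the smallest $\mathbb{F}$-subspace that contains all elements of $R_+$ of degree at most $s$ and is stable under multiplication by $R_+^k$ is $R_+$. Let $\beta(G)=\sup_V\beta(G,V)$ and $\beta_k(G)=\sup_V\beta_k(G,V)$, where $V$ runs over all finite dimensional $G$-modules over $\mathbb{F}$. Then the alternating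 group $A_4$ of degree four satisfies $\beta_k(A_4)=4k+2$ for all $k\ge 1$; in particular, $\beta(A_4)=6$. -/

import Mathlib

universe u v

namespace NoetherNumber

section Graded

variable {F : Type u} [Field F] {A : Type v} [CommRing A] [Algebra F A]

/-- For an `F`-algebra `A` with family of graded pieces `𝒜` and a graded subspace `M` of `A`,
the part `M_{≤ s}` of degree at most `s`. -/
def degLE (𝒜 : ℕ → Submodule F A) (M : Submodule F A) (s : ℕ) : Submodule F A :=
  M ⊓ ⨆ (d : ℕ) (_ : d ≤ s), 𝒜 d

/-- For an `F`-algebra `A` with family of graded pieces `𝒜` and a graded subspace `M` of `A`,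
the part `M_+` of positive degree. -/
def positivePart (𝒜 : ℕ → Submodule F A) (M : Submodule F A) : Submodule F A :=
  M ⊓ ⨆ (d : ℕ) (_ : 1 ≤ d), 𝒜 d

/-- `M` is generated by `M_{≤ s}` as a module over `S`, where `S` is a (possibly non-unital)
graded subalgebra of `A` with `S M ⊆ M`: every `F`-subspace that contains `M_{≤ s}` and is stable
under multiplication by `S` contains `M`. -/
def GeneratedInDegreeLE (𝒜 : ℕ → Submodule F A) (M S : Submodule F A) (s : ℕ) : Prop :=
  ∀ P : Submodule F A, degLE 𝒜 M s ≤ P → S * P ≤ P → M ≤ P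

/-- `β(M, S)`: the least `s` such that `M` is generated by `M_{≤ s}` as an `S`-module
(`⊤` if there is none). -/
noncomputable def beta (𝒜 : ℕ → Submodule F A) (M S : Submodule F A) : ℕ∞ :=
  ⨅ (s : ℕ) (_ : GeneratedInDegreeLE 𝒜 M S s), (s : ℕ∞)

/-- `β(R) = β(R_+, R)` for a graded subalgebra `R` of `A`. -/
noncomputable def betaRing (𝒜 : ℕ → Submodule F A) (R : Subalgebra F A) : ℕ∞ :=
  beta 𝒜 (positivePart 𝒜 R.toSubmodule) R.toSubmodule

/-- `β_k(R) = β_k(R_+, R) = β(R_+, R_+^k)` for a graded subalgebra `R` of `A`; here `R_+^k` is the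
`F`-span of the `k`-fold products of elements of `R_+`. -/
noncomputable def betaRingK (𝒜 : ℕ → Submodule F A) (R : Subalgebra F A) (k : ℕ) : ℕ∞ :=
  beta 𝒜 (positivePart 𝒜 R.toSubmodule) (positivePart 𝒜 R.toSubmodule ^ k)

end Graded

section Invariants

variable {F : Type u} [Field F] {G : Type v} [Group G]
variable {V : Type u} [AddCommGroup V] [Module F V]

variable (F V) in
/-- The coordinate ring `F[V]`: the symmetric algebra of the dual space of `V`. -/
abbrev CoordRing : Type u := SymmetricAlgebra F (Module.Dual F V)

variable (F V) in
/-- The degree `d` homogeneous component of `F[V]`: the span of the products of `d` linear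
forms. -/
def homogPart (d : ℕ) : Submodule F (CoordRing F V) :=
  LinearMap.range (SymmetricAlgebra.ι F (Module.Dual F V)) ^ d

/-- The map `f ↦ f^g` on `F[V]`: the algebra endomorphism with `x^g (v) = x (g v)` for every
linear form `x`. -/
noncomputable def coordAct (ρ : Representation F G V) (g : G) :
    CoordRing F V →ₐ[F] CoordRing F V :=
  SymmetricAlgebra.lift (SymmetricAlgebra.ι F (Module.Dual F V) ∘ₗ (ρ g).dualMap)

/-- The ring of polynomial invariants `F[V]^G`. -/
noncomputable def invariantRing (ρ : Representation F G V) : Subalgebra F (CoordRing F V) :=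
  ⨅ g : G, AlgHom.equalizer (coordAct ρ g) (AlgHom.id F (CoordRing F V))

/-- The Noether number `β(G, V)` of a representation. -/
noncomputable def noetherRep (ρ : Representation F G V) : ℕ∞ :=
  betaRing (homogPart F V) (invariantRing ρ)

/-- The generalized Noether number `β_k(G, V)` of a representation. -/
noncomputable def genNoetherRep (ρ : Representation F G V) (k : ℕ) : ℕ∞ :=
  betaRingK (homogPart F V) (invariantRing ρ) k

end Invariants

/-- The Noether number `β(G)` over `F`: the supremum of `β(G, V)` over all finite dimensional
`G`-modules `V` over `F`. -/
noncomputable def noetherNumber (F : Type u) [Field F] (G : Type v) [Group G] : ℕ∞ :=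
  ⨆ (V : Type u) (_ : AddCommGroup V) (_ : Module F V) (_ : FiniteDimensional F V)
    (ρ : Representation F G V), noetherRep ρ

/-- The generalized Noether number `β_k(G)` over `F`: the supremum of `β_k(G, V)` over all finite
dimensional `G`-modules `V` over `F`. -/
noncomputable def genNoetherNumber (F : Type u) [Field F] (G : Type v) [Group G] (k : ℕ) : ℕ∞ :=
  ⨆ (V : Type u) (_ : AddCommGroup V) (_ : Module F V) (_ : FiniteDimensional F V)
    (ρ : Representation F G V), genNoetherRep ρ k

end NoetherNumber

/-! Upper bound. Let `c` have order three and let K be the Klein four-group. Since 2 is invertible,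
the linear forms split into K-weight spaces: T of trivial weight, and X, Y, Z, which `c` permutes
cyclically. If m is a product of at most four weight vectors and has trivial K-weight, then m + cm +
c²m is an invariant of degree at most 4, so it vanishes modulo the ideal L generated by the
invariants of degrees 1 to 4. These relations alone force every trivial-weight product of degree at
least 7 into L (`CoinvariantRelations.span_pow_mul_eq_bot`). The Reynolds operator kills the other
weights and is linear over the invariants, so R_d is contained in the sum of the R_e R_{d-e} with 1
≤ e ≤ 4, for all d ≥ 7 (`AlternatingFour.invPart_le`). From degree 4(k-1) + 7 = 4k + 3 on, one can
therefore split off k factors of degree at most 4 and keep a cofactor of positive degree, which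
gives generation in degree at most 4k + 2.

Lower bound. On the permutation module, restrict functions to the line through (1, z, z², z³) with
z² = -1. Invariants of degrees 1, 2, 3 vanish there, so R_+ restricts into (X⁴), and R_+^k R_+ into
(X^{4k+4}). The invariant e₄^{k-1}Δ, with e₄ the product of the coordinates and Δ the Vandermonde
product, restricts to a nonzero multiple of X^{4k+2}; generators of degree below 4k + 2 cannot
produce it (`AlternatingFour.le_genNoetherRep_permRep`).

Finally, β is the case k = 1, because R = F + R_+. -/

namespace NoetherNumber

/-! ### Cyclic triples with vanishing traces -/

section Shift

variable {Q : Type*} [CommRing Q]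

/-- The products of `u, u', u''` with `v, v', v''` depend only on the total number of shifts. -/
def ShiftBalanced (u u' u'' v v' v'' : Q) : Prop :=
  (u' * v = u * v' ∧ u' * v' = u * v'' ∧ u' * v'' = u * v) ∧
    (u'' * v = u * v'' ∧ u'' * v' = u * v ∧ u'' * v'' = u * v')

/-- With a primitive cube root of unity ω adjoined, trace zero means u = u₁ + u₂ with u₁, u₂ in the
ω- and ω²-eigenspaces of the shift, and likewise for v. The two product traces kill u₁v₂ and u₂v₁,
so only u₁v₁ and u₂v₂ survive, and on these shifting either factor has the same effect. The proof
below is this elimination without ω. -/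
theorem shiftBalanced_of_trace_eq_zero (h3 : ∀ q : Q, 3 * q = 0 → q = 0) {u u' u'' v v' v'' : Q}
    (hu : u + u' + u'' = 0) (hv : v + v' + v'' = 0)
    (h₀ : u * v + u' * v' + u'' * v'' = 0) (h₁ : u * v' + u' * v'' + u'' * v = 0) :
    ShiftBalanced u u' u'' v v' v'' := by
  have hu'' : u'' = -u - u' := by linear_combination hu
  have hv'' : v'' = -v - v' := by linear_combination hv
  subst hu'' hv''
  have key : u' * v = u * v' := by
    rw [← sub_eq_zero]
    apply h3
    linear_combination -h₀ - 2 * h₁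
  have key' : u' * v' = u * (-v - v') := by
    rw [← sub_eq_zero]
    apply h3
    linear_combination 2 * h₀ + h₁
  refine ⟨⟨key, key', ?_⟩, ?_, ?_, ?_⟩
  · linear_combination -key - key'
  · linear_combination -key
  · linear_combination -key'
  · linear_combination key + key'

end Shift

/-- The relations that hold modulo the invariants of degree at most four of the alternating group
of degree four: `x`, `y`, `z` are the linear forms in the three nontrivial weight spaces of the
Klein four-group, cyclically permuted by an element of order three, and `t`, `t'`, `t''` are the
linear forms of trivial weight, similarly permuted. -/
structure CoinvariantRelations {Q ι κ : Type*} [CommRing Q] (x y z : ι → Q) (t t' t'' : κ → Q) :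
    Prop where
  two : ∀ q : Q, 2 * q = 0 → q = 0
  three : ∀ q : Q, 3 * q = 0 → q = 0
  xx : ∀ i j, x i * x j + y i * y j + z i * z j = 0
  xyz : ∀ i j k, x i * y j * z k + y i * z j * x k + z i * x j * y k = 0
  xxxx : ∀ i j k l,
    x i * x j * (x k * x l) + y i * y j * (y k * y l) + z i * z j * (z k * z l) = 0
  xxyy : ∀ i j k l,
    x i * x j * (y k * y l) + y i * y j * (z k * z l) + z i * z j * (x k * x l) = 0
  tr : ∀ a, t a + t' a + t'' a = 0
  tt : ∀ a b, t a * t b + t' a * t' b + t'' a * t'' b = 0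
  tt' : ∀ a b, t a * t' b + t' a * t'' b + t'' a * t b = 0
  ttt : ∀ a b c, t a * t b * t c + t' a * t' b * t' c + t'' a * t'' b * t'' c = 0
  txx : ∀ a i j, t a * (x i * x j) + t' a * (y i * y j) + t'' a * (z i * z j) = 0
  tyy : ∀ a i j, t a * (y i * y j) + t' a * (z i * z j) + t'' a * (x i * x j) = 0
  ttxx : ∀ a b i j,
    t a * t b * (x i * x j) + t' a * t' b * (y i * y j) + t'' a * t'' b * (z i * z j) = 0
  txyz : ∀ a i j k, t a * (x i * y j * z k) + t' a * (y i * z j * x k)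
    + t'' a * (z i * x j * y k) = 0
  tyzx : ∀ a i j k, t a * (y i * z j * x k) + t' a * (z i * x j * y k)
    + t'' a * (x i * y j * z k) = 0

/-! ### Vanishing monomials modulo the low-degree invariants -/

namespace CoinvariantRelations

variable {Q ι κ : Type*} [CommRing Q] {x y z : ι → Q} {t t' t'' : κ → Q}

theorem rotate (h : CoinvariantRelations x y z t t' t'') :
    CoinvariantRelations y z x t' t'' t where
  two := h.two
  three := h.three
  xx i j := by linear_combination h.xx i j
  xyz i j k := by linear_combination h.xyz i j k
  xxxx i j k l := by linear_combination h.xxxx i j k l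
  xxyy i j k l := by linear_combination h.xxyy i j k l
  tr a := by linear_combination h.tr a
  tt a b := by linear_combination h.tt a b
  tt' a b := by linear_combination h.tt' a b
  ttt a b c := by linear_combination h.ttt a b c
  txx a i j := by linear_combination h.txx a i j
  tyy a i j := by linear_combination h.tyy a i j
  ttxx a b i j := by linear_combination h.ttxx a b i j
  txyz a i j k := by linear_combination h.txyz a i j k
  tyzx a i j k := by linear_combination h.tyzx a i j k

/-- This symmetry comes from an odd permutation, not from the group itself. The third shift of t
against xx or xyz is not among the relations; it is recovered by subtracting the two listed ones
from a multiple of the trace of t. -/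
theorem reflect (h : CoinvariantRelations x y z t t' t'') :
    CoinvariantRelations x z y t t'' t' where
  two := h.two
  three := h.three
  xx i j := by linear_combination h.xx i j
  xyz i j k := by linear_combination h.xyz i k j
  xxxx i j k l := by linear_combination h.xxxx i j k l
  xxyy i j k l := by linear_combination h.xxyy k l i j
  tr a := by linear_combination h.tr a
  tt a b := by linear_combination h.tt a b
  tt' a b := by linear_combination h.tt' b a
  ttt a b c := by linear_combination h.ttt a b c
  txx a i j := by linear_combination h.txx a i j
  tyy a i j := by
    linear_combination (x i * x j + y i * y j + z i * z j) * h.tr a - h.txx a i j - h.tyy a i j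
  ttxx a b i j := by linear_combination h.ttxx a b i j
  txyz a i j k := by linear_combination h.txyz a i k j
  tyzx a i j k := by
    linear_combination (x i * y k * z j + y i * z k * x j + z i * x k * y j) * h.tr a
      - h.txyz a i k j - h.tyzx a i k j

/-- Let A_{ij} be this expression with the pair {i, j} of the five indices placed on y, z and the
other three on x. Symmetrizing `h.xyz` gives A_{ij} + A_{ik} + A_{jk} = 0 for each triple. The
edge-triangle system of the complete graph on five vertices is invertible over ℤ[1/6]: 6A₁₂ is the
sum over triangles with coefficient 2 if they contain or avoid both of 1, 2, and -1 if they contain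
exactly one. -/
theorem xxx_mul_yz_add_yz (h : CoinvariantRelations x y z t t' t'')
    (i₁ i₂ i₃ i₄ i₅ : ι) :
    x i₃ * x i₄ * x i₅ * (y i₁ * z i₂ + y i₂ * z i₁) = 0 := by
  have T (i j k l m : ι) :
      x l * x m * (x k * (y i * z j + y j * z i) + x i * (y j * z k + y k * z j)
        + x j * (y i * z k + y k * z i)) = 0 := by
    linear_combination x l * x m * (h.xyz i j k + h.xyz i k j)
  apply h.two
  apply h.three
  linear_combination 2 * T i₁ i₂ i₃ i₄ i₅
    + 2 * (T i₁ i₂ i₄ i₃ i₅ + T i₁ i₂ i₅ i₃ i₄ - T i₁ i₄ i₅ i₂ i₃ - T i₂ i₄ i₅ i₁ i₃)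
    - (T i₁ i₃ i₄ i₂ i₅ + T i₁ i₃ i₅ i₂ i₄ - T i₁ i₄ i₅ i₂ i₃ - T i₃ i₄ i₅ i₁ i₂)
    - (T i₂ i₃ i₄ i₁ i₅ + T i₂ i₃ i₅ i₁ i₄ - T i₂ i₄ i₅ i₁ i₃ - T i₃ i₄ i₅ i₁ i₂)

/-- The product is symmetric in the two y-indices and, by the previous lemma, antisymmetric under
exchanging a y-index with the z-index. Such a function of three indices equals its own negative. -/
theorem xxxyyz (h : CoinvariantRelations x y z t t' t'')
    (i₁ i₂ i₃ i₄ i₅ i₆ : ι) :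
    x i₁ * x i₂ * x i₃ * (y i₄ * y i₅) * z i₆ = 0 := by
  apply h.two
  linear_combination y i₅ * h.xxx_mul_yz_add_yz i₄ i₆ i₁ i₂ i₃
    - y i₆ * h.xxx_mul_yz_add_yz i₄ i₅ i₁ i₂ i₃ + y i₄ * h.xxx_mul_yz_add_yz i₅ i₆ i₁ i₂ i₃

theorem xxxxxyz (h : CoinvariantRelations x y z t t' t'')
    (i₁ i₂ i₃ i₄ i₅ i₆ i₇ : ι) :
    x i₁ * x i₂ * x i₃ * (x i₄ * x i₅) * y i₆ * z i₇ = 0 := by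
  linear_combination x i₁ * x i₂ * x i₃ * y i₆ * z i₇ * h.xx i₄ i₅
    - y i₆ * h.xxxyyz i₁ i₂ i₃ i₄ i₅ i₇ - z i₇ * h.reflect.xxxyyz i₁ i₂ i₃ i₄ i₅ i₆

/-- Rewriting one factor xxyy by `h.xxyy` leaves two terms, each divisible by a monomial of shape
xxxyyz up to rotation. -/
theorem xxxxyyyy (h : CoinvariantRelations x y z t t' t'')
    (i₁ i₂ i₃ i₄ i₅ i₆ i₇ i₈ : ι) :
    x i₁ * x i₂ * (x i₃ * x i₄) * (y i₅ * y i₆ * (y i₇ * y i₈)) = 0 := by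
  linear_combination x i₃ * x i₄ * y i₇ * y i₈ * h.xxyy i₁ i₂ i₅ i₆
    - y i₈ * x i₄ * h.rotate.xxxyyz i₁ i₂ i₇ i₅ i₆ i₃
    - x i₆ * z i₂ * h.xxxyyz i₃ i₄ i₅ i₇ i₈ i₁

theorem xxxxxxyy (h : CoinvariantRelations x y z t t' t'')
    (i₁ i₂ i₃ i₄ i₅ i₆ i₇ i₈ : ι) :
    x i₁ * x i₂ * (x i₃ * x i₄) * (x i₅ * x i₆) * (y i₇ * y i₈) = 0 := by
  linear_combination x i₃ * x i₄ * x i₅ * x i₆ * y i₇ * y i₈ * h.xx i₁ i₂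
    - h.xxxxyyyy i₃ i₄ i₅ i₆ i₁ i₂ i₇ i₈ - x i₆ * z i₂ * h.xxxyyz i₃ i₄ i₅ i₇ i₈ i₁

theorem xxxxxxxx (h : CoinvariantRelations x y z t t' t'')
    (i₁ i₂ i₃ i₄ i₅ i₆ i₇ i₈ : ι) :
    x i₁ * x i₂ * (x i₃ * x i₄) * (x i₅ * x i₆) * (x i₇ * x i₈) = 0 := by
  linear_combination x i₁ * x i₂ * x i₃ * x i₄ * x i₅ * x i₆ * h.xx i₇ i₈
    - h.xxxxxxyy i₁ i₂ i₃ i₄ i₅ i₆ i₇ i₈ - h.reflect.xxxxxxyy i₁ i₂ i₃ i₄ i₅ i₆ i₇ i₈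

theorem shift_tt (h : CoinvariantRelations x y z t t' t'') (a b : κ) :
    ShiftBalanced (t a) (t' a) (t'' a) (t b) (t' b) (t'' b) :=
  shiftBalanced_of_trace_eq_zero h.three (h.tr a) (h.tr b) (h.tt a b) (h.tt' a b)

theorem shift_txx (h : CoinvariantRelations x y z t t' t'') (a : κ) (i j : ι) :
    ShiftBalanced (t a) (t' a) (t'' a) (x i * x j) (y i * y j) (z i * z j) :=
  shiftBalanced_of_trace_eq_zero h.three (h.tr a) (h.xx i j) (h.txx a i j) (h.tyy a i j)

theorem shift_txyz (h : CoinvariantRelations x y z t t' t'') (a : κ) (i j k : ι) :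
    ShiftBalanced (t a) (t' a) (t'' a) (x i * y j * z k) (y i * z j * x k) (z i * x j * y k) :=
  shiftBalanced_of_trace_eq_zero h.three (h.tr a) (h.xyz i j k) (h.txyz a i j k) (h.tyzx a i j k)

/-- The total shifts 0, 3 and 6 agree modulo 3, so the three terms of the trace `h.ttt` coincide and
the trace is three times the product. -/
theorem t_mul_t_mul_t (h : CoinvariantRelations x y z t t' t'') (a b c : κ) :
    t a * t b * t c = 0 := by
  obtain ⟨⟨-, -, e₁⟩, -, e₂, -⟩ := h.shift_tt a b
  obtain ⟨⟨-, -, e₃⟩, -, e₄, -⟩ := h.shift_tt b c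
  obtain ⟨⟨-, f₁, -⟩, -, -, f₂⟩ := h.shift_tt a b
  apply h.three
  linear_combination h.ttt a b c - t' c * f₁ - t a * e₄ - t'' c * f₂ - t a * e₃

theorem t_mul_t_mul_xx (h : CoinvariantRelations x y z t t' t'') (a b : κ) (i j : ι) :
    t a * t b * (x i * x j) = 0 := by
  obtain ⟨⟨-, -, e₃⟩, -, e₄, -⟩ := h.shift_txx b i j
  obtain ⟨⟨-, f₁, -⟩, -, -, f₂⟩ := h.shift_tt a b
  apply h.three
  linear_combination h.ttxx a b i j - y i * y j * f₁ - t a * e₄ - z i * z j * f₂ - t a * e₃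

/-- The pairs yy and zz are xx shifted once and twice. Exchanging shifts with the t-factor cancels
these three shifts. -/
theorem t_mul_xxyyzz_eq (h : CoinvariantRelations x y z t t' t'') (a : κ)
    (i₁ i₂ i₃ i₄ i₅ i₆ : ι) :
    t a * (x i₁ * x i₂ * (y i₃ * y i₄) * (z i₅ * z i₆)) =
        t a * (x i₁ * x i₂ * (x i₃ * x i₄) * (x i₅ * x i₆)) ∧
      t' a * (x i₁ * x i₂ * (y i₃ * y i₄) * (z i₅ * z i₆)) =
        t' a * (x i₁ * x i₂ * (x i₃ * x i₄) * (x i₅ * x i₆)) ∧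
      t'' a * (x i₁ * x i₂ * (y i₃ * y i₄) * (z i₅ * z i₆)) =
        t'' a * (x i₁ * x i₂ * (x i₃ * x i₄) * (x i₅ * x i₆)) := by
  obtain ⟨⟨e₁, e₂, e₃⟩, e₄, e₅, e₆⟩ := h.shift_txx a i₃ i₄
  obtain ⟨⟨f₁, f₂, f₃⟩, f₄, f₅, f₆⟩ := h.shift_txx a i₅ i₆
  refine ⟨?_, ?_, ?_⟩
  · linear_combination x i₁ * x i₂ * x i₃ * x i₄ * f₃ - x i₁ * x i₂ * z i₅ * z i₆ * e₁
  · linear_combination x i₁ * x i₂ * x i₃ * x i₄ * (f₆ - f₁)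
      + x i₁ * x i₂ * z i₅ * z i₆ * (e₂ - e₄)
  · linear_combination -x i₁ * x i₂ * x i₃ * x i₄ * f₄ + x i₁ * x i₂ * z i₅ * z i₆ * e₅

/-- A product xxyyzz can be regrouped into two triples xyz. Shifting one triple against t and then
collapsing with another choice of pairs shows that t, t', t'' act equally on x⁶; as their sum is
zero, each product is killed by 3. -/
theorem t_mul_xxxxxx (h : CoinvariantRelations x y z t t' t'') (a : κ)
    (i₁ i₂ i₃ i₄ i₅ i₆ : ι) :
    t a * (x i₁ * x i₂ * (x i₃ * x i₄) * (x i₅ * x i₆)) = 0 ∧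
      t' a * (x i₁ * x i₂ * (x i₃ * x i₄) * (x i₅ * x i₆)) = 0 := by
  obtain ⟨e, -, -⟩ := h.t_mul_xxyyzz_eq a i₁ i₂ i₃ i₄ i₅ i₆
  obtain ⟨-, e', -⟩ := h.t_mul_xxyyzz_eq a i₂ i₃ i₄ i₅ i₁ i₆
  obtain ⟨-, -, e''⟩ := h.t_mul_xxyyzz_eq a i₂ i₅ i₁ i₄ i₃ i₆
  obtain ⟨⟨-, -, f⟩, -, g, -⟩ := h.shift_txyz a i₁ i₃ i₅
  have k : t' a * (x i₁ * x i₂ * (x i₃ * x i₄) * (x i₅ * x i₆)) =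
      t a * (x i₁ * x i₂ * (x i₃ * x i₄) * (x i₅ * x i₆)) := by
    linear_combination e - e' + x i₂ * y i₄ * z i₆ * f
  have k' : t'' a * (x i₁ * x i₂ * (x i₃ * x i₄) * (x i₅ * x i₆)) =
      t a * (x i₁ * x i₂ * (x i₃ * x i₄) * (x i₅ * x i₆)) := by
    linear_combination e - e'' + x i₂ * y i₄ * z i₆ * g
  have : t a * (x i₁ * x i₂ * (x i₃ * x i₄) * (x i₅ * x i₆)) = 0 := by
    apply h.three
    linear_combination x i₁ * x i₂ * (x i₃ * x i₄) * (x i₅ * x i₆) * h.tr a - k - k'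
  exact ⟨this, k.trans this⟩

theorem t_mul_xxxxyy (h : CoinvariantRelations x y z t t' t'') (a : κ)
    (i₁ i₂ i₃ i₄ i₅ i₆ : ι) :
    t a * (x i₁ * x i₂ * (x i₃ * x i₄) * (y i₅ * y i₆)) = 0 := by
  obtain ⟨⟨e, -, -⟩, -⟩ := h.shift_txx a i₅ i₆
  linear_combination (h.t_mul_xxxxxx a i₁ i₂ i₃ i₄ i₅ i₆).2 - x i₁ * x i₂ * x i₃ * x i₄ * e

theorem t_mul_xxyyzz (h : CoinvariantRelations x y z t t' t'') (a : κ)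
    (i₁ i₂ i₃ i₄ i₅ i₆ : ι) :
    t a * (x i₁ * x i₂ * (y i₃ * y i₄) * (z i₅ * z i₆)) = 0 :=
  (h.t_mul_xxyyzz_eq a i₁ i₂ i₃ i₄ i₅ i₆).1.trans (h.t_mul_xxxxxx a i₁ i₂ i₃ i₄ i₅ i₆).1

section Span

variable {F : Type*} [Field F] [Algebra F Q]

-- The congruences say that the product has trivial Klein weight. Ten vanishing monomial types
-- suffice once the exponents are sorted.
open Submodule in
set_option linter.unusedSimpArgs false in
theorem span_pow_mul_eq_bot_of_le (h : CoinvariantRelations x y z t t' t'') {p q r s : ℕ}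
    (hrq : r ≤ q) (hsr : s ≤ r) (hqr : q % 2 = r % 2) (hqs : q % 2 = s % 2)
    (hd : 7 ≤ p + q + r + s) :
    span F (Set.range t) ^ p * span F (Set.range x) ^ q * span F (Set.range y) ^ r *
      span F (Set.range z) ^ s = ⊥ := by
  set T := span F (Set.range t) with hT
  set X := span F (Set.range x) with hX
  set Y := span F (Set.range y) with hY
  set Z := span F (Set.range z) with hZ
  have mono {p' q' r' s' : ℕ} (e : T ^ p' * X ^ q' * Y ^ r' * Z ^ s' = ⊥)
      (hle : p' ≤ p ∧ q' ≤ q ∧ r' ≤ r ∧ s' ≤ s) : T ^ p * X ^ q * Y ^ r * Z ^ s = ⊥ := by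
    obtain ⟨hp, hq, hr, hs⟩ := hle
    obtain ⟨p, rfl⟩ := Nat.exists_eq_add_of_le hp
    obtain ⟨q, rfl⟩ := Nat.exists_eq_add_of_le hq
    obtain ⟨r, rfl⟩ := Nat.exists_eq_add_of_le hr
    obtain ⟨s, rfl⟩ := Nat.exists_eq_add_of_le hs
    calc _ = T ^ p' * X ^ q' * Y ^ r' * Z ^ s' * (T ^ p * X ^ q * Y ^ r * Z ^ s) := by ring
      _ = ⊥ := by rw [e, Submodule.bot_mul]
  have e₁ : T ^ 0 * X ^ 3 * Y ^ 2 * Z ^ 1 = ⊥ := by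
    simp only [hT, hX, hY, hZ, pow_succ, pow_zero, one_mul, mul_one, span_mul_span, span_eq_bot,
      ← Set.image2_mul, Set.forall_mem_image2, Set.forall_mem_range]
    intro i₁ i₂ i₃ i₄ i₅ i₆
    linear_combination h.xxxyyz i₁ i₂ i₃ i₄ i₅ i₆
  have e₂ : T ^ 0 * X ^ 5 * Y ^ 1 * Z ^ 1 = ⊥ := by
    simp only [hT, hX, hY, hZ, pow_succ, pow_zero, one_mul, mul_one, span_mul_span, span_eq_bot,
      ← Set.image2_mul, Set.forall_mem_image2, Set.forall_mem_range]
    intro i₁ i₂ i₃ i₄ i₅ i₆ i₇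
    linear_combination h.xxxxxyz i₁ i₂ i₃ i₄ i₅ i₆ i₇
  have e₃ : T ^ 0 * X ^ 4 * Y ^ 4 * Z ^ 0 = ⊥ := by
    simp only [hT, hX, hY, hZ, pow_succ, pow_zero, one_mul, mul_one, span_mul_span, span_eq_bot,
      ← Set.image2_mul, Set.forall_mem_image2, Set.forall_mem_range]
    intro i₁ i₂ i₃ i₄ i₅ i₆ i₇ i₈
    linear_combination h.xxxxyyyy i₁ i₂ i₃ i₄ i₅ i₆ i₇ i₈
  have e₄ : T ^ 0 * X ^ 6 * Y ^ 2 * Z ^ 0 = ⊥ := by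
    simp only [hT, hX, hY, hZ, pow_succ, pow_zero, one_mul, mul_one, span_mul_span, span_eq_bot,
      ← Set.image2_mul, Set.forall_mem_image2, Set.forall_mem_range]
    intro i₁ i₂ i₃ i₄ i₅ i₆ i₇ i₈
    linear_combination h.xxxxxxyy i₁ i₂ i₃ i₄ i₅ i₆ i₇ i₈
  have e₅ : T ^ 0 * X ^ 8 * Y ^ 0 * Z ^ 0 = ⊥ := by
    simp only [hT, hX, hY, hZ, pow_succ, pow_zero, one_mul, mul_one, span_mul_span, span_eq_bot,
      ← Set.image2_mul, Set.forall_mem_image2, Set.forall_mem_range]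
    intro i₁ i₂ i₃ i₄ i₅ i₆ i₇ i₈
    linear_combination h.xxxxxxxx i₁ i₂ i₃ i₄ i₅ i₆ i₇ i₈
  have e₆ : T ^ 3 * X ^ 0 * Y ^ 0 * Z ^ 0 = ⊥ := by
    simp only [hT, hX, hY, hZ, pow_succ, pow_zero, one_mul, mul_one, span_mul_span, span_eq_bot,
      ← Set.image2_mul, Set.forall_mem_image2, Set.forall_mem_range]
    intro a b c
    linear_combination h.t_mul_t_mul_t a b c
  have e₇ : T ^ 2 * X ^ 2 * Y ^ 0 * Z ^ 0 = ⊥ := by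
    simp only [hT, hX, hY, hZ, pow_succ, pow_zero, one_mul, mul_one, span_mul_span, span_eq_bot,
      ← Set.image2_mul, Set.forall_mem_image2, Set.forall_mem_range]
    intro a b i j
    linear_combination h.t_mul_t_mul_xx a b i j
  have e₈ : T ^ 1 * X ^ 2 * Y ^ 2 * Z ^ 2 = ⊥ := by
    simp only [hT, hX, hY, hZ, pow_succ, pow_zero, one_mul, mul_one, span_mul_span, span_eq_bot,
      ← Set.image2_mul, Set.forall_mem_image2, Set.forall_mem_range]
    intro a i₁ i₂ i₃ i₄ i₅ i₆
    linear_combination h.t_mul_xxyyzz a i₁ i₂ i₃ i₄ i₅ i₆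
  have e₉ : T ^ 1 * X ^ 4 * Y ^ 2 * Z ^ 0 = ⊥ := by
    simp only [hT, hX, hY, hZ, pow_succ, pow_zero, one_mul, mul_one, span_mul_span, span_eq_bot,
      ← Set.image2_mul, Set.forall_mem_image2, Set.forall_mem_range]
    intro a i₁ i₂ i₃ i₄ i₅ i₆
    linear_combination h.t_mul_xxxxyy a i₁ i₂ i₃ i₄ i₅ i₆
  have e₁₀ : T ^ 1 * X ^ 6 * Y ^ 0 * Z ^ 0 = ⊥ := by
    simp only [hT, hX, hY, hZ, pow_succ, pow_zero, one_mul, mul_one, span_mul_span, span_eq_bot,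
      ← Set.image2_mul, Set.forall_mem_image2, Set.forall_mem_range]
    intro a i₁ i₂ i₃ i₄ i₅ i₆
    linear_combination (h.t_mul_xxxxxx a i₁ i₂ i₃ i₄ i₅ i₆).1
  -- Otherwise the exponents dominate none of the ten types, and with the parity and ordering
  -- constraints this leaves total degree at most 6.
  by_contra hne
  have n₁ := mt (mono e₁) hne
  have n₂ := mt (mono e₂) hne
  have n₃ := mt (mono e₃) hne
  have n₄ := mt (mono e₄) hne
  have n₅ := mt (mono e₅) hne
  have n₆ := mt (mono e₆) hne
  have n₇ := mt (mono e₇) hne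
  have n₈ := mt (mono e₈) hne
  have n₉ := mt (mono e₉) hne
  have n₁₀ := mt (mono e₁₀) hne
  clear mono e₁ e₂ e₃ e₄ e₅ e₆ e₇ e₈ e₉ e₁₀ hne
  omega

-- Rotations and the reflection reduce to sorted exponents. They may replace t by t' or t'', which
-- is harmless since these have the same range.
open Submodule in
theorem span_pow_mul_eq_bot (h : CoinvariantRelations x y z t t' t'') {p q r s : ℕ}
    (hqr : q % 2 = r % 2) (hqs : q % 2 = s % 2) (hd : 7 ≤ p + q + r + s)
    (ht' : Set.range t' = Set.range t) (ht'' : Set.range t'' = Set.range t) :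
    span F (Set.range t) ^ p * span F (Set.range x) ^ q * span F (Set.range y) ^ r *
      span F (Set.range z) ^ s = ⊥ := by
  rcases le_total r q with h₁ | h₁ <;> rcases le_total s r with h₂ | h₂ <;>
    rcases le_total s q with h₃ | h₃
  · exact h.span_pow_mul_eq_bot_of_le h₁ h₂ hqr hqs hd
  · exact h.span_pow_mul_eq_bot_of_le h₁ h₂ hqr hqs hd
  · rw [← h.reflect.span_pow_mul_eq_bot_of_le (F := F) (p := p) h₃ h₂ hqs hqr (by omega)]
    ring
  · rw [← h.rotate.rotate.span_pow_mul_eq_bot_of_le (F := F) (p := p) h₃ h₁ hqs.symm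
      (by omega) (by omega), ht'']
    ring
  · rw [← h.rotate.reflect.span_pow_mul_eq_bot_of_le (F := F) (p := p) h₁ h₃ hqr.symm
      (by omega) (by omega), ht']
    ring
  · rw [← h.rotate.span_pow_mul_eq_bot_of_le (F := F) (p := p) h₂ h₃ (by omega)
      (by omega) (by omega), ht']
    ring
  · rw [← h.rotate.rotate.reflect.span_pow_mul_eq_bot_of_le (F := F) (p := p) h₂ h₁ (by omega)
      (by omega) (by omega), ht'']
    ring
  · rw [← h.rotate.rotate.reflect.span_pow_mul_eq_bot_of_le (F := F) (p := p) h₂ h₁ (by omega)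
      (by omega) (by omega), ht'']
    ring

end Span

end CoinvariantRelations

end NoetherNumber

namespace NoetherNumber

/-! ### Homogeneous components of the coordinate ring -/

section Grading

variable {F : Type u} [Field F] {V : Type u} [AddCommGroup V] [Module F V]

theorem ι_mem_homogPart_one (w : Module.Dual F V) :
    SymmetricAlgebra.ι F _ w ∈ homogPart F V 1 := by
  rw [homogPart, pow_one]
  exact ⟨w, rfl⟩

theorem homogPart_mul (a b : ℕ) : homogPart F V a * homogPart F V b = homogPart F V (a + b) :=
  (pow_add _ a b).symm

theorem iSup_homogPart : ⨆ d, homogPart F V d = ⊤ := by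
  rw [eq_top_iff]
  rintro s -
  induction s using SymmetricAlgebra.induction with
  | algebraMap r =>
    refine Submodule.mem_iSup_of_mem 0 ?_
    rw [homogPart, pow_zero]
    exact Submodule.algebraMap_mem r
  | ι w => exact Submodule.mem_iSup_of_mem 1 (ι_mem_homogPart_one w)
  | mul a b ha hb =>
    have hab := Submodule.mul_mem_mul ha hb
    rw [Submodule.iSup_mul] at hab
    refine (iSup_le fun i => ?_ : _ ≤ ⨆ d, homogPart F V d) hab
    rw [Submodule.mul_iSup]
    exact iSup_le fun j => (homogPart_mul i j).le.trans (le_iSup (homogPart F V) (i + j))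
  | add a b ha hb => exact add_mem ha hb

variable (F V) in
/-- The algebra homomorphism `F[V] → F[V][T]` that maps every linear form `w` to `w T`. -/
noncomputable def gradingHom : CoordRing F V →ₐ[F] Polynomial (CoordRing F V) :=
  SymmetricAlgebra.lift
    ((LinearMap.mulLeft F Polynomial.X) ∘ₗ
      (Algebra.linearMap (CoordRing F V) (Polynomial (CoordRing F V))).restrictScalars F ∘ₗ
      SymmetricAlgebra.ι F (Module.Dual F V))

theorem gradingHom_of_mem {d : ℕ} {s : CoordRing F V} (hs : s ∈ homogPart F V d) :
    gradingHom F V s = Polynomial.C s * Polynomial.X ^ d := by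
  induction d generalizing s with
  | zero =>
    rw [homogPart, pow_zero, Submodule.mem_one] at hs
    obtain ⟨r, rfl⟩ := hs
    rw [AlgHom.commutes, pow_zero, mul_one]
    rfl
  | succ d ih =>
    rw [homogPart, pow_succ] at hs
    induction hs using Submodule.mul_induction_on' with
    | mem_mul_mem a ha b hb =>
      obtain ⟨w, rfl⟩ := hb
      rw [map_mul, ih ha, gradingHom, SymmetricAlgebra.lift_ι_apply]
      simp
      ring
    | add a _ b _ ha hb => rw [map_add, ha, hb, map_add, add_mul]

/-- The homogeneous component of degree `d`. -/
noncomputable def component (d : ℕ) : CoordRing F V →ₗ[F] CoordRing F V :=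
  (Polynomial.lcoeff (CoordRing F V) d).restrictScalars F ∘ₗ (gradingHom F V).toLinearMap

theorem component_apply (d : ℕ) (s : CoordRing F V) :
    component d s = (gradingHom F V s).coeff d := rfl

theorem component_of_mem {d e : ℕ} {s : CoordRing F V} (hs : s ∈ homogPart F V e) :
    component d s = if d = e then s else 0 := by
  rw [component_apply, gradingHom_of_mem hs, Polynomial.coeff_C_mul_X_pow]

theorem component_mem (d : ℕ) (s : CoordRing F V) : component d s ∈ homogPart F V d := by
  have hs : s ∈ ⨆ d, homogPart F V d := iSup_homogPart (F := F) (V := V) ▸ Submodule.mem_top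
  induction hs using Submodule.iSup_induction' with
  | mem e s hs =>
    rw [component_of_mem hs]
    split_ifs with h
    · rwa [h]
    · exact zero_mem _
  | zero => rw [map_zero]; exact zero_mem _
  | add a b _ _ ha hb => rw [map_add]; exact add_mem ha hb

theorem component_mul {d e : ℕ} (hed : e ≤ d) (s : CoordRing F V) {r : CoordRing F V}
    (hr : r ∈ homogPart F V e) : component d (s * r) = component (d - e) s * r := by
  rw [component_apply, component_apply, map_mul, gradingHom_of_mem hr, ← mul_assoc,
    Polynomial.coeff_mul_X_pow', if_pos hed, Polynomial.coeff_mul_C]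

end Grading

/-! ### The Reynolds operator and degree reduction -/

section Reynolds

variable {F : Type u} [Field F] {G : Type v} [Group G]
variable {V : Type u} [AddCommGroup V] [Module F V] (ρ : Representation F G V)

@[simp]
theorem coordAct_ι (g : G) (w : Module.Dual F V) :
    coordAct ρ g (SymmetricAlgebra.ι F _ w) = SymmetricAlgebra.ι F _ ((ρ g).dualMap w) := by
  simp [coordAct]

/-- Dualizing reverses composition, so this is a right action. -/
theorem coordAct_coordAct (g h : G) (s : CoordRing F V) :
    coordAct ρ h (coordAct ρ g s) = coordAct ρ (g * h) s := by
  rw [← AlgHom.comp_apply]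
  congr 1
  refine SymmetricAlgebra.algHom_ext (LinearMap.ext fun w => ?_)
  change coordAct ρ h (coordAct ρ g (SymmetricAlgebra.ι F _ w)) =
    coordAct ρ (g * h) (SymmetricAlgebra.ι F _ w)
  simp only [coordAct_ι]
  exact congrArg _ (LinearMap.ext fun v => by simp)

theorem coordAct_one (s : CoordRing F V) : coordAct ρ 1 s = s := by
  suffices coordAct ρ 1 = AlgHom.id F _ by rw [this]; rfl
  refine SymmetricAlgebra.algHom_ext (LinearMap.ext fun w => ?_)
  change coordAct ρ 1 (SymmetricAlgebra.ι F _ w) = SymmetricAlgebra.ι F _ w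
  rw [coordAct_ι]
  exact congrArg _ (LinearMap.ext fun v => by simp)

theorem mem_invariantRing {s : CoordRing F V} :
    s ∈ invariantRing ρ ↔ ∀ g, coordAct ρ g s = s := by
  simp [invariantRing, Algebra.mem_iInf, AlgHom.mem_equalizer]

theorem coordAct_mem_homogPart (g : G) {d : ℕ} {s : CoordRing F V} (hs : s ∈ homogPart F V d) :
    coordAct ρ g s ∈ homogPart F V d := by
  have h : Submodule.map (coordAct ρ g).toLinearMap (homogPart F V d) ≤ homogPart F V d := by
    rw [homogPart, Submodule.map_pow]
    refine pow_le_pow_left' ?_ d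
    rintro _ ⟨_, ⟨w, rfl⟩, rfl⟩
    exact ⟨_, (coordAct_ι ρ g w).symm⟩
  exact h ⟨s, hs, rfl⟩

/-- The invariants that are homogeneous of degree `d`. -/
noncomputable def invPart (d : ℕ) : Submodule F (CoordRing F V) :=
  (invariantRing ρ).toSubmodule ⊓ homogPart F V d

theorem iSup_invPart_le_degLE (s : ℕ) :
    ⨆ (d : ℕ) (_ : 1 ≤ d ∧ d ≤ s), invPart ρ d ≤
      degLE (homogPart F V) (positivePart (homogPart F V) (invariantRing ρ).toSubmodule) s := by
  refine iSup₂_le fun d hd => le_inf (le_inf inf_le_left ?_) ?_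
  · exact inf_le_right.trans (le_iSup₂_of_le d hd.1 le_rfl)
  · exact inf_le_right.trans (le_iSup₂_of_le d hd.2 le_rfl)

/-- Each application of `h` splits off one factor and lowers the degree by at most N, so the k-th is
still allowed when d ≥ N(k-1) + c. The inequality is written with `d + N` to avoid subtraction, and
`N < c` keeps the final cofactor in positive degree. -/
theorem invPart_le_pow_mul {N c : ℕ} (hc : N < c)
    (h : ∀ d, c ≤ d → invPart ρ d ≤ ⨆ e ∈ Set.Icc 1 N, invPart ρ e * invPart ρ (d - e))
    (k d : ℕ) (hd : N * k + c ≤ d + N) :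
    invPart ρ d ≤ (⨆ (e : ℕ) (_ : 1 ≤ e), invPart ρ e) ^ k *
      ⨆ (e : ℕ) (_ : 1 ≤ e ∧ e + k ≤ d), invPart ρ e := by
  induction k generalizing d with
  | zero =>
    rw [pow_zero, one_mul]
    exact le_iSup₂_of_le d ⟨by omega, le_rfl⟩ le_rfl
  | succ k ih =>
    rw [mul_add, mul_one] at hd
    refine (h d (by omega)).trans (iSup₂_le fun e he => ?_)
    obtain ⟨he, he'⟩ := he
    rw [pow_succ', mul_assoc]
    refine mul_le_mul' (le_iSup₂_of_le e he le_rfl) ((ih (d - e) (by omega)).trans ?_)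
    refine mul_le_mul' le_rfl (iSup₂_le fun i hi => ?_)
    exact le_iSup₂_of_le i ⟨hi.1, by omega⟩ le_rfl

variable [Fintype G]

/-- The Reynolds operator: the average over the group. -/
noncomputable def reynolds : CoordRing F V →ₗ[F] CoordRing F V :=
  (Fintype.card G : F)⁻¹ • ∑ g : G, (coordAct ρ g).toLinearMap

theorem reynolds_apply (s : CoordRing F V) :
    reynolds ρ s = (Fintype.card G : F)⁻¹ • ∑ g : G, coordAct ρ g s := by
  simp [reynolds]

theorem reynolds_mem (s : CoordRing F V) : reynolds ρ s ∈ invariantRing ρ := by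
  rw [mem_invariantRing]
  intro h
  rw [reynolds_apply, map_smul, map_sum]
  congr 1
  simp only [coordAct_coordAct]
  exact Fintype.sum_equiv (Equiv.mulRight h) _ _ fun _ => rfl

theorem reynolds_coordAct (h : G) (s : CoordRing F V) :
    reynolds ρ (coordAct ρ h s) = reynolds ρ s := by
  rw [reynolds_apply, reynolds_apply]
  congr 1
  simp only [coordAct_coordAct]
  exact Fintype.sum_equiv (Equiv.mulLeft h) _ _ fun _ => rfl

theorem reynolds_mul {r : CoordRing F V} (hr : r ∈ invariantRing ρ) (s : CoordRing F V) :
    reynolds ρ (r * s) = r * reynolds ρ s := by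
  rw [mem_invariantRing] at hr
  simp only [reynolds_apply, map_mul, hr, ← Finset.mul_sum, mul_smul_comm]

theorem reynolds_mem_invPart {d : ℕ} {s : CoordRing F V} (hs : s ∈ homogPart F V d) :
    reynolds ρ s ∈ invPart ρ d := by
  refine ⟨reynolds_mem ρ s, ?_⟩
  rw [reynolds_apply]
  exact Submodule.smul_mem _ _ (sum_mem fun g _ => coordAct_mem_homogPart ρ g hs)

theorem reynolds_mem_of_mem_span {N d : ℕ} (hN : N ≤ d) {s : CoordRing F V}
    (hs : s ∈ homogPart F V d)
    (hs' : s ∈ Ideal.span (⋃ e ∈ Set.Icc 1 N, (invPart ρ e : Set (CoordRing F V)))) :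
    reynolds ρ s ∈ ⨆ e ∈ Set.Icc 1 N, invPart ρ e * invPart ρ (d - e) := by
  -- Ideal membership does not preserve homogeneity along the induction, so the claim is generalized
  -- to the degree d component of an arbitrary element of the ideal.
  suffices reynolds ρ (component d s) ∈ ⨆ e ∈ Set.Icc 1 N, invPart ρ e * invPart ρ (d - e) by
    rwa [component_of_mem hs, if_pos rfl] at this
  clear hs
  induction hs' using Submodule.closure_induction with
  | zero => rw [map_zero, map_zero]; exact zero_mem _
  | add a b _ _ ha hb => rw [map_add, map_add]; exact add_mem ha hb
  | smul_mem a r hr =>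
    simp only [Set.mem_iUnion] at hr
    obtain ⟨e, he, hr⟩ := hr
    rw [smul_eq_mul, component_mul (he.2.trans hN) a hr.2, mul_comm, reynolds_mul ρ hr.1]
    exact Submodule.mem_iSup_of_mem e (Submodule.mem_iSup_of_mem he
      (Submodule.mul_mem_mul hr (reynolds_mem_invPart ρ (component_mem _ _))))

variable (hG : (Fintype.card G : F) ≠ 0)
include hG

theorem reynolds_of_mem {s : CoordRing F V} (hs : s ∈ invariantRing ρ) : reynolds ρ s = s := by
  rw [mem_invariantRing] at hs
  simp only [reynolds_apply, hs, Finset.sum_const, Finset.card_univ]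
  rw [← Nat.cast_smul_eq_nsmul F, smul_smul, inv_mul_cancel₀ hG, one_smul]

/-- The Reynolds operator preserves degree and fixes invariants, so it projects a sum of homogeneous
pieces onto a sum of homogeneous invariants. -/
theorem inf_iSup_homogPart_eq (p : ℕ → Prop) :
    (invariantRing ρ).toSubmodule ⊓ ⨆ (d : ℕ) (_ : p d), homogPart F V d =
      ⨆ (d : ℕ) (_ : p d), invPart ρ d := by
  refine le_antisymm ?_ (iSup₂_le fun d hd => inf_le_inf_left _ (le_iSup₂_of_le d hd le_rfl))
  rintro s ⟨hs, hs'⟩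
  rw [← reynolds_of_mem ρ hG hs]
  suffices h : (⨆ (d : ℕ) (_ : p d), homogPart F V d).map (reynolds ρ) ≤
      ⨆ (d : ℕ) (_ : p d), invPart ρ d from h ⟨s, hs', rfl⟩
  simp only [Submodule.map_iSup]
  refine iSup₂_mono fun d _ => ?_
  rintro _ ⟨a, ha, rfl⟩
  exact reynolds_mem_invPart ρ ha

theorem positivePart_eq : positivePart (homogPart F V) (invariantRing ρ).toSubmodule =
    ⨆ (d : ℕ) (_ : 1 ≤ d), invPart ρ d :=
  inf_iSup_homogPart_eq ρ hG _

theorem generatedInDegreeLE_of_invPart_le {N c : ℕ} (hc : N < c)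
    (h : ∀ d, c ≤ d → invPart ρ d ≤ ⨆ e ∈ Set.Icc 1 N, invPart ρ e * invPart ρ (d - e))
    {k s : ℕ} (hk : 1 ≤ k) (hs : N * k + c ≤ s + 1 + N) :
    GeneratedInDegreeLE (homogPart F V)
      (positivePart (homogPart F V) (invariantRing ρ).toSubmodule)
      (positivePart (homogPart F V) (invariantRing ρ).toSubmodule ^ k) s := by
  intro P hP hmul
  rw [positivePart_eq ρ hG] at hmul ⊢
  replace hP := (iSup_invPart_le_degLE ρ s).trans hP
  refine iSup₂_le fun d hd => ?_
  induction d using Nat.strong_induction_on with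
  | _ d ih =>
    rcases le_or_gt d s with hds | hds
    · exact (le_iSup₂_of_le d ⟨hd, hds⟩ le_rfl).trans hP
    · refine (invPart_le_pow_mul ρ hc h k d (by omega)).trans (le_trans ?_ hmul)
      -- The cofactor has degree e with e + k ≤ d; this is a strict drop because k ≥ 1.
      exact mul_le_mul' le_rfl (iSup₂_le fun e he => ih e (by omega) he.1)

theorem toSubmodule_invariantRing_le :
    (invariantRing ρ).toSubmodule ≤
      1 ⊔ positivePart (homogPart F V) (invariantRing ρ).toSubmodule := by
  rw [positivePart_eq ρ hG]
  have := inf_iSup_homogPart_eq ρ hG fun _ => True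
  simp only [iSup_true, iSup_homogPart, inf_top_eq] at this
  refine this.le.trans (iSup_le fun d => ?_)
  rcases Nat.eq_zero_or_pos d with rfl | hd
  · refine le_sup_of_le_left (inf_le_right.trans ?_)
    rw [homogPart, pow_zero]
  · exact le_sup_of_le_right (le_iSup₂_of_le d hd le_rfl)

/-- Since R is contained in F + R_+, stability of a subspace under R_+ and under R amount to the
same thing. -/
theorem genNoetherRep_one : genNoetherRep ρ 1 = noetherRep ρ := by
  have key (s : ℕ) : GeneratedInDegreeLE (homogPart F V)
        (positivePart (homogPart F V) (invariantRing ρ).toSubmodule)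
        (positivePart (homogPart F V) (invariantRing ρ).toSubmodule ^ 1) s ↔
      GeneratedInDegreeLE (homogPart F V)
        (positivePart (homogPart F V) (invariantRing ρ).toSubmodule)
        (invariantRing ρ).toSubmodule s := by
    rw [pow_one]
    refine forall_congr' fun P => imp_congr_right fun _ => imp_congr_left ⟨fun h => ?_, fun h => ?_⟩
    · refine (mul_le_mul' (toSubmodule_invariantRing_le ρ hG) le_rfl).trans ?_
      rw [Submodule.sup_mul, one_mul]
      exact sup_le le_rfl h
    · exact (mul_le_mul' inf_le_left le_rfl).trans h
  simp only [genNoetherRep, noetherRep, betaRingK, betaRing, beta, key]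

end Reynolds

end NoetherNumber

namespace NoetherNumber

section SupPow

variable {F A : Type*} [Field F] [CommRing A] [Algebra F A]

theorem sup_pow_le (M₁ M₂ M₃ M₄ P : Submodule F A) (n : ℕ)
    (h : ∀ p q r s, p + q + r + s = n → M₁ ^ p * M₂ ^ q * M₃ ^ r * M₄ ^ s ≤ P) :
    (M₁ ⊔ M₂ ⊔ M₃ ⊔ M₄) ^ n ≤ P := by
  suffices key : (M₁ ⊔ M₂ ⊔ M₃ ⊔ M₄) ^ n ≤ ⨆ (p : ℕ) (q : ℕ) (r : ℕ) (s : ℕ)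
      (_ : p + q + r + s = n), M₁ ^ p * M₂ ^ q * M₃ ^ r * M₄ ^ s from
    key.trans (iSup_le fun p => iSup_le fun q => iSup_le fun r => iSup₂_le fun s hs =>
      h p q r s hs)
  clear h
  have le {n p q r s : ℕ} (hs : p + q + r + s = n) {N : Submodule F A}
      (hN : N = M₁ ^ p * M₂ ^ q * M₃ ^ r * M₄ ^ s) :
      N ≤ ⨆ (p : ℕ) (q : ℕ) (r : ℕ) (s : ℕ)
        (_ : p + q + r + s = n), M₁ ^ p * M₂ ^ q * M₃ ^ r * M₄ ^ s :=
    hN ▸ le_iSup_of_le p (le_iSup_of_le q (le_iSup_of_le r (le_iSup₂_of_le s hs le_rfl)))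
  induction n with
  | zero => exact le (p := 0) (q := 0) (r := 0) (s := 0) rfl (by simp)
  | succ n ih =>
    rw [pow_succ]
    refine (mul_le_mul' ih le_rfl).trans ?_
    simp only [Submodule.iSup_mul]
    refine iSup_le fun p => iSup_le fun q => iSup_le fun r => iSup₂_le fun s hs => ?_
    simp only [Submodule.mul_sup]
    refine sup_le (sup_le (sup_le ?_ ?_) ?_) ?_
    · exact le (p := p + 1) (q := q) (r := r) (s := s) (by omega) (by ring)
    · exact le (p := p) (q := q + 1) (r := r) (s := s) (by omega) (by ring)
    · exact le (p := p) (q := q) (r := r + 1) (s := s) (by omega) (by ring)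
    · exact le (p := p) (q := q) (r := r) (s := s + 1) (by omega) (by ring)

end SupPow

/-! ### Klein four-group weights and the upper bound -/

namespace AlternatingFour

open Equiv

/-- An element of order three of the alternating group of degree four. -/
def c : alternatingGroup (Fin 4) := ⟨swap 0 1 * swap 1 2, Perm.mem_alternatingGroup.mpr (by decide)⟩

/-- A double transposition. -/
def k₁ : alternatingGroup (Fin 4) := ⟨swap 0 1 * swap 2 3, Perm.mem_alternatingGroup.mpr (by decide)⟩

/-- The conjugate `c k₁ c⁻¹`. -/
def k₂ : alternatingGroup (Fin 4) := ⟨swap 0 3 * swap 1 2, Perm.mem_alternatingGroup.mpr (by decide)⟩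

theorem c_mul_k₁ : c * k₁ = k₂ * c := by decide

theorem c_mul_k₂ : c * k₂ = k₁ * k₂ * c := by decide

theorem k₁_mul_k₁ : k₁ * k₁ = 1 := by decide

theorem k₂_mul_k₂ : k₂ * k₂ = 1 := by decide

theorem k₁_mul_k₂ : k₁ * k₂ = k₂ * k₁ := by decide

theorem c_mul_c_mul_c : c * c * c = 1 := by decide

theorem exists_eq_mul : ∀ g : alternatingGroup (Fin 4),
    ∃ (i : Fin 3) (a b : Fin 2), g = c ^ (i : ℕ) * (k₁ ^ (a : ℕ) * k₂ ^ (b : ℕ)) := by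
  decide

theorem card_eq : Fintype.card (alternatingGroup (Fin 4)) = 12 := by decide

theorem card_cast_ne_zero {F : Type*} [Field F] (h2 : (2 : F) ≠ 0) (h3 : (3 : F) ≠ 0) :
    (Fintype.card (alternatingGroup (Fin 4)) : F) ≠ 0 := by
  rw [card_eq, show ((12 : ℕ) : F) = 2 * 2 * 3 by norm_num]
  exact mul_ne_zero (mul_ne_zero h2 h2) h3

variable {F : Type u} [Field F] {V : Type u} [AddCommGroup V] [Module F V]
variable (ρ : Representation F (alternatingGroup (Fin 4)) V)

/-- The simultaneous eigenspace of `k₁` and `k₂` with eigenvalues `a` and `b`. -/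
noncomputable def weight (a b : F) : Submodule F (CoordRing F V) :=
  Module.End.eigenspace (coordAct ρ k₁).toLinearMap a ⊓
    Module.End.eigenspace (coordAct ρ k₂).toLinearMap b

theorem mem_weight {a b : F} {s : CoordRing F V} :
    s ∈ weight ρ a b ↔ coordAct ρ k₁ s = a • s ∧ coordAct ρ k₂ s = b • s := by
  simp [weight]

theorem weight_mul_le (a b a' b' : F) :
    weight ρ a b * weight ρ a' b' ≤ weight ρ (a * a') (b * b') := by
  rw [Submodule.mul_le]
  intro s hs s' hs'
  rw [mem_weight] at hs hs' ⊢
  simp only [map_mul, hs, hs', smul_mul_smul_comm, and_self]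

theorem weight_pow_le (a b : F) (n : ℕ) : weight ρ a b ^ n ≤ weight ρ (a ^ n) (b ^ n) := by
  induction n with
  | zero =>
    rw [pow_zero, pow_zero, pow_zero, Submodule.one_le, mem_weight]
    simp
  | succ n ih =>
    rw [pow_succ, pow_succ, pow_succ]
    exact (mul_le_mul' ih le_rfl).trans (weight_mul_le ρ _ _ _ _)

/-- Conjugation by `c` cycles the three involutions, hence the nontrivial weights: (1,-1), (-1,-1),
(-1,1). -/
theorem coordAct_c_mem_weight {a b : F} {s : CoordRing F V} (hs : s ∈ weight ρ a b) :
    coordAct ρ c s ∈ weight ρ b (a * b) := by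
  rw [mem_weight] at hs ⊢
  rw [coordAct_coordAct, c_mul_k₁, ← coordAct_coordAct, hs.2, map_smul, coordAct_coordAct,
    c_mul_k₂, ← coordAct_coordAct, ← coordAct_coordAct, hs.1, map_smul, hs.2, smul_smul, map_smul]
  exact ⟨rfl, rfl⟩

theorem coordAct_c_c_c (s : CoordRing F V) :
    coordAct ρ c (coordAct ρ c (coordAct ρ c s)) = s := by
  rw [coordAct_coordAct, coordAct_coordAct, ← mul_assoc, c_mul_c_mul_c, coordAct_one]

theorem mem_invariantRing_of_generators {s : CoordRing F V} (hc : coordAct ρ c s = s)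
    (h₁ : coordAct ρ k₁ s = s) (h₂ : coordAct ρ k₂ s = s) : s ∈ invariantRing ρ := by
  have hmul {g h} (hg : coordAct ρ g s = s) (hh : coordAct ρ h s = s) :
      coordAct ρ (g * h) s = s := by rw [← coordAct_coordAct, hg, hh]
  have hpow {g} (hg : coordAct ρ g s = s) (n : ℕ) : coordAct ρ (g ^ n) s = s := by
    induction n with
    | zero => rw [pow_zero, coordAct_one]
    | succ n ih => rw [pow_succ]; exact hmul ih hg
  rw [mem_invariantRing]
  intro g
  obtain ⟨i, a, b, rfl⟩ := exists_eq_mul g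
  exact hmul (hpow hc i) (hmul (hpow h₁ a) (hpow h₂ b))

/-- The homogeneous elements of degree `d` in the eigenspace `weight ρ a b`. -/
noncomputable def weightPart (d : ℕ) (a b : F) : Submodule F (CoordRing F V) :=
  weight ρ a b ⊓ homogPart F V d

variable {ρ} in
theorem mul_mem_weightPart {d d' : ℕ} {a b a' b' : F} {s s' : CoordRing F V}
    (hs : s ∈ weightPart ρ d a b) (hs' : s' ∈ weightPart ρ d' a' b') :
    s * s' ∈ weightPart ρ (d + d') (a * a') (b * b') :=
  ⟨weight_mul_le ρ a b a' b' (Submodule.mul_mem_mul hs.1 hs'.1),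
    homogPart_mul (F := F) (V := V) d d' ▸ Submodule.mul_mem_mul hs.2 hs'.2⟩

variable {ρ} in
theorem coordAct_c_mem_weightPart {d : ℕ} {a b : F} {s : CoordRing F V}
    (hs : s ∈ weightPart ρ d a b) : coordAct ρ c s ∈ weightPart ρ d b (a * b) :=
  ⟨coordAct_c_mem_weight ρ hs.1, coordAct_mem_homogPart ρ c hs.2⟩

theorem trace_mem_invPart {d : ℕ} {s : CoordRing F V} (hs : s ∈ weightPart ρ d 1 1) :
    s + coordAct ρ c s + coordAct ρ c (coordAct ρ c s) ∈ invPart ρ d := by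
  have h₁ := coordAct_c_mem_weightPart hs
  rw [one_mul] at h₁
  have h₂ := coordAct_c_mem_weightPart h₁
  rw [one_mul] at h₂
  have hsum := add_mem (add_mem hs h₁) h₂
  have hw := (mem_weight ρ).mp hsum.1
  rw [one_smul] at hw
  refine ⟨mem_invariantRing_of_generators ρ ?_ hw.1 hw.2, hsum.2⟩
  rw [map_add, map_add, coordAct_c_c_c]
  ring

/-- The ideal generated by the homogeneous invariants of degree `1, …, 4`. -/
noncomputable def lowIdeal : Ideal (CoordRing F V) :=
  Ideal.span (⋃ e ∈ Set.Icc 1 4, (invPart ρ e : Set (CoordRing F V)))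

theorem mk_trace {d : ℕ} {s : CoordRing F V} (hs : s ∈ weightPart ρ d 1 1) (hd : 1 ≤ d)
    (hd' : d ≤ 4) :
    Ideal.Quotient.mkₐ F (lowIdeal ρ) s + Ideal.Quotient.mkₐ F (lowIdeal ρ) (coordAct ρ c s) +
      Ideal.Quotient.mkₐ F (lowIdeal ρ) (coordAct ρ c (coordAct ρ c s)) = 0 := by
  rw [← map_add, ← map_add, Ideal.Quotient.mkₐ_eq_mk, Ideal.Quotient.eq_zero_iff_mem]
  exact Ideal.subset_span (Set.mem_biUnion (Set.mem_Icc.mpr ⟨hd, hd'⟩) (trace_mem_invPart ρ hs))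

theorem coinvariantRelations (h2 : (2 : F) ≠ 0) (h3 : (3 : F) ≠ 0) :
    CoinvariantRelations
      (fun w : weightPart ρ 1 1 (-1) => Ideal.Quotient.mkₐ F (lowIdeal ρ) w)
      (fun w : weightPart ρ 1 1 (-1) => Ideal.Quotient.mkₐ F (lowIdeal ρ) (coordAct ρ c w))
      (fun w : weightPart ρ 1 1 (-1) =>
        Ideal.Quotient.mkₐ F (lowIdeal ρ) (coordAct ρ c (coordAct ρ c w)))
      (fun w : weightPart ρ 1 1 1 => Ideal.Quotient.mkₐ F (lowIdeal ρ) w)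
      (fun w : weightPart ρ 1 1 1 => Ideal.Quotient.mkₐ F (lowIdeal ρ) (coordAct ρ c w))
      (fun w : weightPart ρ 1 1 1 =>
        Ideal.Quotient.mkₐ F (lowIdeal ρ) (coordAct ρ c (coordAct ρ c w))) := by
  have hx (w : weightPart ρ 1 1 (-1)) : (w : CoordRing F V) ∈ weightPart ρ 1 1 (-1) := w.2
  have hy (w : weightPart ρ 1 1 (-1)) : coordAct ρ c w ∈ weightPart ρ 1 (-1) (-1) := by
    simpa using coordAct_c_mem_weightPart w.2
  have hz (w : weightPart ρ 1 1 (-1)) :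
      coordAct ρ c (coordAct ρ c w) ∈ weightPart ρ 1 (-1) 1 := by
    simpa using coordAct_c_mem_weightPart (hy w)
  have ht (w : weightPart ρ 1 1 1) : (w : CoordRing F V) ∈ weightPart ρ 1 1 1 := w.2
  have ht' (w : weightPart ρ 1 1 1) : coordAct ρ c w ∈ weightPart ρ 1 1 1 := by
    simpa using coordAct_c_mem_weightPart w.2
  have mk {d : ℕ} {a b : F} {s : CoordRing F V} (hs : s ∈ weightPart ρ d a b) (ha : a = 1)
      (hb : b = 1) (hd : 1 ≤ d) (hd' : d ≤ 4) := mk_trace ρ (ha ▸ hb ▸ hs) hd hd'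
  constructor
  case two =>
    intro q hq
    rw [← map_ofNat (algebraMap F _) 2] at hq
    exact ((IsUnit.mk0 _ h2).map (algebraMap F _)).mul_right_eq_zero.mp hq
  case three =>
    intro q hq
    rw [← map_ofNat (algebraMap F _) 3] at hq
    exact ((IsUnit.mk0 _ h3).map (algebraMap F _)).mul_right_eq_zero.mp hq
  case xx =>
    intro i j
    have := mk (mul_mem_weightPart (hx i) (hx j)) (by norm_num) (by norm_num) (by norm_num)
      (by norm_num)
    simpa only [map_mul, coordAct_c_c_c] using this
  case xyz =>
    intro i j k
    have := mk (mul_mem_weightPart (mul_mem_weightPart (hx i) (hy j)) (hz k)) (by norm_num)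
      (by norm_num) (by norm_num) (by norm_num)
    simpa only [map_mul, coordAct_c_c_c] using this
  case xxxx =>
    intro i j k l
    have := mk (mul_mem_weightPart (mul_mem_weightPart (hx i) (hx j))
      (mul_mem_weightPart (hx k) (hx l))) (by norm_num) (by norm_num) (by norm_num) (by norm_num)
    simpa only [map_mul, coordAct_c_c_c] using this
  case xxyy =>
    intro i j k l
    have := mk (mul_mem_weightPart (mul_mem_weightPart (hx i) (hx j))
      (mul_mem_weightPart (hy k) (hy l))) (by norm_num) (by norm_num) (by norm_num) (by norm_num)
    simpa only [map_mul, coordAct_c_c_c] using this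
  case tr =>
    intro a
    exact mk (ht a) rfl rfl (by norm_num) (by norm_num)
  case tt =>
    intro a b
    have := mk (mul_mem_weightPart (ht a) (ht b)) (by norm_num) (by norm_num) (by norm_num)
      (by norm_num)
    simpa only [map_mul, coordAct_c_c_c] using this
  case tt' =>
    intro a b
    have := mk (mul_mem_weightPart (ht a) (ht' b)) (by norm_num) (by norm_num) (by norm_num)
      (by norm_num)
    simpa only [map_mul, coordAct_c_c_c] using this
  case ttt =>
    intro a b d
    have := mk (mul_mem_weightPart (mul_mem_weightPart (ht a) (ht b)) (ht d)) (by norm_num)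
      (by norm_num) (by norm_num) (by norm_num)
    simpa only [map_mul, coordAct_c_c_c] using this
  case txx =>
    intro a i j
    have := mk (mul_mem_weightPart (ht a) (mul_mem_weightPart (hx i) (hx j))) (by norm_num)
      (by norm_num) (by norm_num) (by norm_num)
    simpa only [map_mul, coordAct_c_c_c] using this
  case tyy =>
    intro a i j
    have := mk (mul_mem_weightPart (ht a) (mul_mem_weightPart (hy i) (hy j))) (by norm_num)
      (by norm_num) (by norm_num) (by norm_num)
    simpa only [map_mul, coordAct_c_c_c] using this
  case ttxx =>
    intro a b i j
    have := mk (mul_mem_weightPart (mul_mem_weightPart (ht a) (ht b))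
      (mul_mem_weightPart (hx i) (hx j))) (by norm_num) (by norm_num) (by norm_num) (by norm_num)
    simpa only [map_mul, coordAct_c_c_c] using this
  case txyz =>
    intro a i j k
    have := mk (mul_mem_weightPart (ht a) (mul_mem_weightPart
      (mul_mem_weightPart (hx i) (hy j)) (hz k))) (by norm_num) (by norm_num) (by norm_num)
      (by norm_num)
    simpa only [map_mul, coordAct_c_c_c] using this
  case tyzx =>
    intro a i j k
    have := mk (mul_mem_weightPart (ht a) (mul_mem_weightPart
      (mul_mem_weightPart (hy i) (hz j)) (hx k))) (by norm_num) (by norm_num) (by norm_num)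
      (by norm_num)
    simpa only [map_mul, coordAct_c_c_c] using this

/-- The four character projectors of the Klein group sum to the identity; they need only that 4 is
invertible. -/
theorem homogPart_one_le (h2 : (2 : F) ≠ 0) :
    homogPart F V 1 ≤ weightPart ρ 1 1 1 ⊔ weightPart ρ 1 1 (-1) ⊔ weightPart ρ 1 (-1) (-1) ⊔
      weightPart ρ 1 (-1) 1 := by
  intro s hs
  have h₁ := coordAct_mem_homogPart ρ k₁ hs
  have h₂ := coordAct_mem_homogPart ρ k₂ hs
  have h₃ := coordAct_mem_homogPart ρ k₂ h₁
  have hk₁ (s : CoordRing F V) : coordAct ρ k₁ (coordAct ρ k₁ s) = s := by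
    rw [coordAct_coordAct, k₁_mul_k₁, coordAct_one]
  have hk₂ (s : CoordRing F V) : coordAct ρ k₂ (coordAct ρ k₂ s) = s := by
    rw [coordAct_coordAct, k₂_mul_k₂, coordAct_one]
  have hk (s : CoordRing F V) :
      coordAct ρ k₁ (coordAct ρ k₂ s) = coordAct ρ k₂ (coordAct ρ k₁ s) := by
    rw [coordAct_coordAct, coordAct_coordAct, k₁_mul_k₂]
  have part (a b : F) (ha : a = 1 ∨ a = -1) (hb : b = 1 ∨ b = -1) :
      (4 : F)⁻¹ • (s + a • coordAct ρ k₁ s + b • coordAct ρ k₂ s +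
        (a * b) • coordAct ρ k₂ (coordAct ρ k₁ s)) ∈ weightPart ρ 1 a b := by
    refine Submodule.smul_mem _ _ ⟨(mem_weight ρ).mpr ?_, ?_⟩
    · rcases ha with rfl | rfl <;> rcases hb with rfl | rfl <;>
        simp only [map_add, map_smul, hk₁, hk₂, hk] <;> exact ⟨by module, by module⟩
    · exact add_mem (add_mem (add_mem hs (Submodule.smul_mem _ _ h₁))
        (Submodule.smul_mem _ _ h₂)) (Submodule.smul_mem _ _ h₃)
  have h4 : (4 : F) ≠ 0 := by
    rw [show (4 : F) = 2 * 2 by norm_num]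
    exact mul_ne_zero h2 h2
  have key := Submodule.add_mem_sup (Submodule.add_mem_sup (Submodule.add_mem_sup
    (part 1 1 (.inl rfl) (.inl rfl)) (part 1 (-1) (.inl rfl) (.inr rfl)))
    (part (-1) (-1) (.inr rfl) (.inr rfl))) (part (-1) 1 (.inr rfl) (.inl rfl))
  convert key using 1
  match_scalars <;> field_simp <;> norm_num

/-- Averaging absorbs group elements, so an element negated by one of them has an average equal to
its own negative. -/
theorem reynolds_eq_zero_of_mem_weight (h2 : (2 : F) ≠ 0) {a b : F} {s : CoordRing F V}
    (hs : s ∈ weight ρ a b) (hab : a = -1 ∨ b = -1) : reynolds ρ s = 0 := by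
  rw [mem_weight] at hs
  have key (g : alternatingGroup (Fin 4)) (hg : coordAct ρ g s = (-1 : F) • s) :
      reynolds ρ s = 0 := by
    have h := reynolds_coordAct ρ g s
    rw [hg, map_smul] at h
    have h' : (2 : F) • reynolds ρ s = 0 := by
      rw [two_smul]
      nth_rewrite 1 [← h]
      module
    rw [← inv_smul_smul₀ h2 (reynolds ρ s), h', smul_zero]
  rcases hab with rfl | rfl
  · exact key _ hs.1
  · exact key _ hs.2

theorem weightPart_pow_le_lowIdeal (h2 : (2 : F) ≠ 0) (h3 : (3 : F) ≠ 0) {p q r s : ℕ}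
    (hqr : q % 2 = r % 2) (hqs : q % 2 = s % 2) (hd : 7 ≤ p + q + r + s) :
    weightPart ρ 1 1 1 ^ p * weightPart ρ 1 1 (-1) ^ q * weightPart ρ 1 (-1) (-1) ^ r *
      weightPart ρ 1 (-1) 1 ^ s ≤ (lowIdeal ρ).restrictScalars F := by
  have hy {w} (hw : w ∈ weightPart ρ 1 1 (-1)) : coordAct ρ c w ∈ weightPart ρ 1 (-1) (-1) := by
    simpa using coordAct_c_mem_weightPart hw
  have hz {w} (hw : w ∈ weightPart ρ 1 (-1) (-1)) : coordAct ρ c w ∈ weightPart ρ 1 (-1) 1 := by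
    simpa using coordAct_c_mem_weightPart hw
  have hx {w} (hw : w ∈ weightPart ρ 1 (-1) 1) : coordAct ρ c w ∈ weightPart ρ 1 1 (-1) := by
    simpa using coordAct_c_mem_weightPart hw
  have ht {w} (hw : w ∈ weightPart ρ 1 1 1) : coordAct ρ c w ∈ weightPart ρ 1 1 1 := by
    simpa using coordAct_c_mem_weightPart hw
  have hker : (lowIdeal ρ).restrictScalars F =
      LinearMap.ker (Ideal.Quotient.mkₐ F (lowIdeal ρ)).toLinearMap := by
    ext s
    simp [Ideal.Quotient.eq_zero_iff_mem]
  rw [hker, LinearMap.le_ker_iff_map, Submodule.map_mul, Submodule.map_mul, Submodule.map_mul,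
    Submodule.map_pow, Submodule.map_pow, Submodule.map_pow, Submodule.map_pow, ← le_bot_iff]
  refine le_trans ?_ ((coinvariantRelations ρ h2 h3).span_pow_mul_eq_bot (F := F) (p := p)
    hqr hqs hd ?_ ?_).le
  · refine mul_le_mul' (mul_le_mul' (mul_le_mul' (pow_le_pow_left' ?_ p) (pow_le_pow_left' ?_ q))
      (pow_le_pow_left' ?_ r)) (pow_le_pow_left' ?_ s)
    · rintro _ ⟨w, hw, rfl⟩
      exact Submodule.subset_span ⟨⟨w, hw⟩, rfl⟩
    · rintro _ ⟨w, hw, rfl⟩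
      exact Submodule.subset_span ⟨⟨w, hw⟩, rfl⟩
    · rintro _ ⟨w, hw, rfl⟩
      -- The relations index Y and Z by X through `c` and `c²`. As `c³ = 1`, each w in Y is `c`
      -- applied to `c²w` in X, and in the next case each w in Z is `c²` applied to `cw`.
      exact Submodule.subset_span ⟨⟨_, hx (hz hw)⟩, by simp only [coordAct_c_c_c]; rfl⟩
    · rintro _ ⟨w, hw, rfl⟩
      exact Submodule.subset_span ⟨⟨_, hx hw⟩, by simp only [coordAct_c_c_c]; rfl⟩
  · refine Set.Subset.antisymm ?_ ?_
    · rintro _ ⟨w, rfl⟩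
      exact ⟨⟨_, ht w.2⟩, rfl⟩
    · rintro _ ⟨w, rfl⟩
      exact ⟨⟨_, ht (ht w.2)⟩, by simp only [coordAct_c_c_c]⟩
  · refine Set.Subset.antisymm ?_ ?_
    · rintro _ ⟨w, rfl⟩
      exact ⟨⟨_, ht (ht w.2)⟩, rfl⟩
    · rintro _ ⟨w, rfl⟩
      exact ⟨⟨_, ht w.2⟩, by simp only [coordAct_c_c_c]⟩

theorem invPart_le (h2 : (2 : F) ≠ 0) (h3 : (3 : F) ≠ 0) (d : ℕ) (hd : 7 ≤ d) :
    invPart ρ d ≤ ⨆ e ∈ Set.Icc 1 4, invPart ρ e * invPart ρ (d - e) := by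
  have hG := card_cast_ne_zero h2 h3
  rintro f ⟨hf, hf'⟩
  rw [← reynolds_of_mem ρ hG hf]
  suffices key : homogPart F V 1 ^ d ≤
      (⨆ e ∈ Set.Icc 1 4, invPart ρ e * invPart ρ (d - e)).comap (reynolds ρ) by
    refine key ?_
    rwa [homogPart, pow_one]
  refine (pow_le_pow_left' (homogPart_one_le ρ h2) d).trans (sup_pow_le _ _ _ _ _ d ?_)
  intro p q r s hsum a ha
  rw [Submodule.mem_comap]
  have hw : a ∈ weight ρ ((-1) ^ (r + s)) ((-1) ^ (q + r)) := by
    have h₁ := mul_le_mul' (mul_le_mul' (mul_le_mul'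
      (pow_le_pow_left' (inf_le_left : weightPart ρ 1 1 1 ≤ _) p)
      (pow_le_pow_left' (inf_le_left : weightPart ρ 1 1 (-1) ≤ _) q))
      (pow_le_pow_left' (inf_le_left : weightPart ρ 1 (-1) (-1) ≤ _) r))
      (pow_le_pow_left' (inf_le_left : weightPart ρ 1 (-1) 1 ≤ _) s)
    have h₂ := mul_le_mul' (mul_le_mul' (mul_le_mul' (weight_pow_le ρ 1 1 p)
      (weight_pow_le ρ 1 (-1) q)) (weight_pow_le ρ (-1) (-1) r)) (weight_pow_le ρ (-1) 1 s)
    have h₄ : a ∈ weight ρ (1 ^ p * 1 ^ q * (-1) ^ r * (-1) ^ s)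
        (1 ^ p * (-1) ^ q * (-1) ^ r * 1 ^ s) :=
      (h₁.trans (h₂.trans ((mul_le_mul' ((mul_le_mul' (weight_mul_le ρ _ _ _ _) le_rfl).trans
        (weight_mul_le ρ _ _ _ _)) le_rfl).trans (weight_mul_le ρ _ _ _ _)))) ha
    simpa only [one_pow, one_mul, mul_one, pow_add] using h₄
  rcases Nat.even_or_odd (r + s) with hrs | hrs
  · rcases Nat.even_or_odd (q + r) with hqr | hqr
    · have hmem : a ∈ homogPart F V d := by
        have h₁ := mul_le_mul' (mul_le_mul' (mul_le_mul'
          (pow_le_pow_left' (inf_le_right : weightPart ρ 1 1 1 ≤ _) p)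
          (pow_le_pow_left' (inf_le_right : weightPart ρ 1 1 (-1) ≤ _) q))
          (pow_le_pow_left' (inf_le_right : weightPart ρ 1 (-1) (-1) ≤ _) r))
          (pow_le_pow_left' (inf_le_right : weightPart ρ 1 (-1) 1 ≤ _) s) ha
        rwa [← pow_add, ← pow_add, ← pow_add, hsum, homogPart, pow_one] at h₁
      rw [Nat.even_iff] at hrs hqr
      exact reynolds_mem_of_mem_span ρ (by omega) hmem
        (weightPart_pow_le_lowIdeal ρ h2 h3 (by omega) (by omega) (by omega) ha)
    · rw [reynolds_eq_zero_of_mem_weight ρ h2 hw (.inr hqr.neg_one_pow)]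
      exact zero_mem _
  · rw [reynolds_eq_zero_of_mem_weight ρ h2 hw (.inl hrs.neg_one_pow)]
    exact zero_mem _

theorem genNoetherRep_le (h2 : (2 : F) ≠ 0) (h3 : (3 : F) ≠ 0) {k : ℕ} (hk : 1 ≤ k) :
    genNoetherRep ρ k ≤ ((4 * k + 2 : ℕ) : ℕ∞) := by
  have hG := card_cast_ne_zero h2 h3
  -- With N = 4 and c = 7 the bound 4k + 7 ≤ s + 5 is sharp at s = 4k + 2.
  exact iInf₂_le (4 * k + 2) (generatedInDegreeLE_of_invPart_le ρ hG (by norm_num : 4 < 7)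
    (invPart_le ρ h2 h3) hk (by omega))

end AlternatingFour

end NoetherNumber

namespace NoetherNumber

/-! ### The permutation module and the lower bound -/

namespace AlternatingFour

variable (F : Type u) [Field F]

/-- The permutation representation of the alternating group of degree four. -/
noncomputable def permRep : Representation F (alternatingGroup (Fin 4)) (Fin 4 → F) where
  toFun g := LinearMap.funLeft F F ((g⁻¹ : alternatingGroup (Fin 4)) : Equiv.Perm (Fin 4))
  map_one' := by ext; simp [LinearMap.funLeft]
  map_mul' g h := by
    ext
    simp [LinearMap.funLeft]

/-- The coordinate functions. -/
noncomputable def coord (i : Fin 4) : CoordRing F (Fin 4 → F) :=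
  SymmetricAlgebra.ι F _ (LinearMap.proj i)

theorem coordAct_coord (g : alternatingGroup (Fin 4)) (i : Fin 4) :
    coordAct (permRep F) g (coord F i) =
      coord F (((g⁻¹ : alternatingGroup (Fin 4)) : Equiv.Perm (Fin 4)) i) := by
  rw [coord, coordAct_ι]
  rfl

theorem coord_mem (i : Fin 4) : coord F i ∈ homogPart F (Fin 4 → F) 1 :=
  ι_mem_homogPart_one _

theorem homogPart_one_eq_span :
    homogPart F (Fin 4 → F) 1 = Submodule.span F (Set.range (coord F)) := by
  refine le_antisymm ?_ (Submodule.span_le.mpr ?_)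
  · rw [homogPart, pow_one]
    rintro _ ⟨w, rfl⟩
    have hw : w = ∑ i, w (Pi.single i 1) • LinearMap.proj i := by
      refine LinearMap.pi_ext' fun j => LinearMap.ext_ring ?_
      simp [Pi.single_apply]
    rw [hw, map_sum]
    refine sum_mem fun i _ => ?_
    rw [map_smul]
    exact Submodule.smul_mem _ _ (Submodule.subset_span ⟨i, rfl⟩)
  · rintro _ ⟨i, rfl⟩
    exact coord_mem F i

/-- The product of the coordinate functions. -/
noncomputable def coordProd : CoordRing F (Fin 4 → F) :=
  coord F 0 * coord F 1 * coord F 2 * coord F 3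

/-- The product of the differences of the coordinate functions. -/
noncomputable def vandermonde : CoordRing F (Fin 4 → F) :=
  (coord F 0 - coord F 1) * (coord F 0 - coord F 2) * (coord F 0 - coord F 3) *
    (coord F 1 - coord F 2) * (coord F 1 - coord F 3) * (coord F 2 - coord F 3)

theorem coordAct_generators_coord :
    (coordAct (permRep F) c (coord F 0) = coord F 2 ∧
      coordAct (permRep F) c (coord F 1) = coord F 0 ∧
      coordAct (permRep F) c (coord F 2) = coord F 1 ∧
      coordAct (permRep F) c (coord F 3) = coord F 3) ∧
    (coordAct (permRep F) k₁ (coord F 0) = coord F 1 ∧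
      coordAct (permRep F) k₁ (coord F 1) = coord F 0 ∧
      coordAct (permRep F) k₁ (coord F 2) = coord F 3 ∧
      coordAct (permRep F) k₁ (coord F 3) = coord F 2) ∧
    (coordAct (permRep F) k₂ (coord F 0) = coord F 3 ∧
      coordAct (permRep F) k₂ (coord F 1) = coord F 2 ∧
      coordAct (permRep F) k₂ (coord F 2) = coord F 1 ∧
      coordAct (permRep F) k₂ (coord F 3) = coord F 0) := by
  simp only [coordAct_coord]
  refine ⟨⟨?_, ?_, ?_, ?_⟩, ⟨?_, ?_, ?_, ?_⟩, ?_, ?_, ?_, ?_⟩ <;> exact congrArg _ (by decide)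

theorem coordProd_mem : coordProd F ∈ invPart (permRep F) 4 := by
  obtain ⟨⟨c₀, c₁, c₂, c₃⟩, ⟨a₀, a₁, a₂, a₃⟩, b₀, b₁, b₂, b₃⟩ := coordAct_generators_coord F
  refine ⟨mem_invariantRing_of_generators _ ?_ ?_ ?_, ?_⟩
  · simp only [coordProd, map_mul, c₀, c₁, c₂, c₃]; ring
  · simp only [coordProd, map_mul, a₀, a₁, a₂, a₃]; ring
  · simp only [coordProd, map_mul, b₀, b₁, b₂, b₃]; ring
  · have h := coord_mem F
    have := Submodule.mul_mem_mul (Submodule.mul_mem_mul (Submodule.mul_mem_mul (h 0) (h 1)) (h 2))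
      (h 3)
    rwa [homogPart_mul, homogPart_mul, homogPart_mul] at this

theorem vandermonde_mem : vandermonde F ∈ invPart (permRep F) 6 := by
  obtain ⟨⟨c₀, c₁, c₂, c₃⟩, ⟨a₀, a₁, a₂, a₃⟩, b₀, b₁, b₂, b₃⟩ := coordAct_generators_coord F
  refine ⟨mem_invariantRing_of_generators _ ?_ ?_ ?_, ?_⟩
  · simp only [vandermonde, map_mul, map_sub, c₀, c₁, c₂, c₃]; ring
  · simp only [vandermonde, map_mul, map_sub, a₀, a₁, a₂, a₃]; ring
  · simp only [vandermonde, map_mul, map_sub, b₀, b₁, b₂, b₃]; ring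
  · have h (i j : Fin 4) : coord F i - coord F j ∈ homogPart F (Fin 4 → F) 1 :=
      sub_mem (coord_mem F i) (coord_mem F j)
    have := Submodule.mul_mem_mul (Submodule.mul_mem_mul (Submodule.mul_mem_mul
      (Submodule.mul_mem_mul (Submodule.mul_mem_mul (h 0 1) (h 0 2)) (h 0 3)) (h 1 2)) (h 1 3))
      (h 2 3)
    rwa [homogPart_mul, homogPart_mul, homogPart_mul, homogPart_mul, homogPart_mul] at this

section Evaluation

variable {K : Type*} [Field K] [Algebra F K] (z : K)

open Polynomial

/-- The restriction of polynomial functions to the line through `(1, z, z², z³)`. -/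
noncomputable def evalLine : CoordRing F (Fin 4 → F) →ₐ[F] K[X] :=
  SymmetricAlgebra.lift (∑ i : Fin 4, (LinearMap.applyₗ (Pi.single i (1 : F))).smulRight
    (C (z ^ (i : ℕ)) * X : K[X]))

theorem evalLine_coord (i : Fin 4) : evalLine F z (coord F i) = C (z ^ (i : ℕ)) * X := by
  simp [evalLine, coord, Pi.single_apply]

theorem exists_evalLine_eq {d : ℕ} {s : CoordRing F (Fin 4 → F)}
    (hs : s ∈ homogPart F (Fin 4 → F) d) : ∃ a : K, evalLine F z s = C a * X ^ d := by
  induction d generalizing s with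
  | zero =>
    rw [homogPart, pow_zero, Submodule.mem_one] at hs
    obtain ⟨r, rfl⟩ := hs
    exact ⟨algebraMap F K r, by rw [AlgHom.commutes, pow_zero, mul_one]; rfl⟩
  | succ d ih =>
    rw [← homogPart_mul] at hs
    induction hs using Submodule.mul_induction_on' with
    | mem_mul_mem a ha b hb =>
      obtain ⟨r, hr⟩ := ih ha
      rw [homogPart_one_eq_span] at hb
      have hb' : ∃ r : K, evalLine F z b = C r * X := by
        induction hb using Submodule.span_induction with
        | mem b hb =>
          obtain ⟨i, rfl⟩ := hb
          exact ⟨_, evalLine_coord F z i⟩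
        | zero => exact ⟨0, by simp⟩
        | add a b _ _ ha hb =>
          obtain ⟨r, hr⟩ := ha
          obtain ⟨r', hr'⟩ := hb
          exact ⟨r + r', by rw [map_add, hr, hr', C_add, add_mul]⟩
        | smul a b _ hb =>
          obtain ⟨r, hr⟩ := hb
          exact ⟨algebraMap F K a * r, by
            rw [map_smul, hr, C_mul, mul_assoc, Algebra.smul_def]; rfl⟩
      obtain ⟨r', hr'⟩ := hb'
      exact ⟨r * r', by rw [map_mul, hr, hr', C_mul]; ring⟩
    | add a _ b _ ha hb =>
      obtain ⟨r, hr⟩ := ha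
      obtain ⟨r', hr'⟩ := hb
      exact ⟨r + r', by rw [map_add, hr, hr', C_add, add_mul]⟩

variable {z}

theorem pow_val_add (hz : z ^ 2 = -1) (i j : Fin 4) :
    z ^ ((i + j : Fin 4) : ℕ) = z ^ (i : ℕ) * z ^ (j : ℕ) := by
  have h4 : z ^ 4 = 1 := by
    rw [show 4 = 2 * 2 from rfl, pow_mul, hz]
    norm_num
  rw [← pow_add, Fin.val_add]
  conv_rhs => rw [← Nat.div_add_mod ((i : ℕ) + j) 4, pow_add, pow_mul, h4, one_pow, one_mul]

/-- Residues j and j + 2 contribute opposite powers of z, so equal counts cancel. -/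
theorem sum_pow_val_eq_zero (hz : z ^ 2 = -1) {α : Type*} [Fintype α] (e : α → Fin 4)
    (h₀ : (Finset.univ.filter fun g => e g = 0).card = (Finset.univ.filter fun g => e g = 2).card)
    (h₁ : (Finset.univ.filter fun g => e g = 1).card =
      (Finset.univ.filter fun g => e g = 3).card) :
    ∑ g, z ^ (e g : ℕ) = 0 := by
  rw [← Finset.sum_fiberwise Finset.univ e]
  have h (j : Fin 4) : ∑ g ∈ Finset.univ.filter (fun g => e g = j), z ^ (e g : ℕ) =
      (Finset.univ.filter fun g => e g = j).card * z ^ (j : ℕ) := by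
    rw [← nsmul_eq_mul]
    exact Finset.sum_eq_card_nsmul fun g hg => by rw [(Finset.mem_filter.mp hg).2]
  simp only [h, Fin.sum_univ_four, h₀, h₁]
  simp only [Fin.val_zero, Fin.val_one, Fin.val_two, show ((3 : Fin 4) : ℕ) = 3 from rfl]
  linear_combination ((Finset.univ.filter fun g => e g = 2).card +
    (Finset.univ.filter fun g => e g = 3).card * z : K) * hz

theorem sum_pow_perm₁ (hz : z ^ 2 = -1) (a : Fin 4) :
    ∑ g : alternatingGroup (Fin 4), z ^ ((g : Equiv.Perm (Fin 4)) a : ℕ) = 0 := by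
  refine sum_pow_val_eq_zero hz (fun g : alternatingGroup (Fin 4) =>
    (g : Equiv.Perm (Fin 4)) a) ?_ ?_ <;>
    revert a <;> decide +kernel

theorem sum_pow_perm₂ (hz : z ^ 2 = -1) (a b : Fin 4) :
    ∑ g : alternatingGroup (Fin 4), z ^ ((g : Equiv.Perm (Fin 4)) a : ℕ) *
      z ^ ((g : Equiv.Perm (Fin 4)) b : ℕ) = 0 := by
  simp only [← pow_val_add hz]
  refine sum_pow_val_eq_zero hz (fun g : alternatingGroup (Fin 4) =>
    (g : Equiv.Perm (Fin 4)) a + (g : Equiv.Perm (Fin 4)) b) ?_ ?_ <;>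
    revert a b <;> decide +kernel

theorem sum_pow_perm₃ (hz : z ^ 2 = -1) (a b d : Fin 4) :
    ∑ g : alternatingGroup (Fin 4), z ^ ((g : Equiv.Perm (Fin 4)) a : ℕ) *
      z ^ ((g : Equiv.Perm (Fin 4)) b : ℕ) * z ^ ((g : Equiv.Perm (Fin 4)) d : ℕ) = 0 := by
  simp only [← pow_val_add hz]
  refine sum_pow_val_eq_zero hz (fun g : alternatingGroup (Fin 4) =>
    (g : Equiv.Perm (Fin 4)) a + (g : Equiv.Perm (Fin 4)) b + (g : Equiv.Perm (Fin 4)) d)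
    ?_ ?_ <;>
    revert a b d <;> decide +kernel

/-- The coordinates of (1, z, z², z³) are the roots of T⁴ - 1, whose first three elementary
symmetric functions vanish. Here the vanishing is checked on monomials, by counting exponents modulo
4 over the group. -/
theorem evalLine_reynolds_eq_zero (hz : z ^ 2 = -1) {d : ℕ} (hd : 1 ≤ d) (hd' : d ≤ 3) :
    homogPart F (Fin 4 → F) d ≤
      LinearMap.ker ((evalLine F z).toLinearMap ∘ₗ reynolds (permRep F)) := by
  have key (s : CoordRing F (Fin 4 → F))
      -- Summing over inverses cancels the inverse in the action on coordinates.
      (hs : ∑ g, evalLine F z (coordAct (permRep F) g⁻¹ s) = 0) :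
      s ∈ LinearMap.ker ((evalLine F z).toLinearMap ∘ₗ reynolds (permRep F)) := by
    rw [LinearMap.mem_ker, LinearMap.comp_apply, reynolds_apply, AlgHom.toLinearMap_apply,
      map_smul, map_sum, ← Fintype.sum_equiv (Equiv.inv (alternatingGroup (Fin 4)))
        (fun g => evalLine F z (coordAct (permRep F) g⁻¹ s)) _ fun _ => rfl, hs, smul_zero]
  have hS := homogPart_one_eq_span F
  interval_cases d
  · rw [hS, Submodule.span_le]
    rintro _ ⟨a, rfl⟩
    refine key _ ?_
    simp only [coordAct_coord, inv_inv, evalLine_coord]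
    rw [← Finset.sum_mul, ← map_sum, sum_pow_perm₁ hz, map_zero, zero_mul]
  · rw [← homogPart_mul 1 1, hS, Submodule.span_mul_span, Submodule.span_le]
    rintro _ ⟨_, ⟨a, rfl⟩, _, ⟨b, rfl⟩, rfl⟩
    refine key _ ?_
    simp only [coordAct_coord, inv_inv, evalLine_coord, map_mul, mul_mul_mul_comm _ X _ X]
    simp only [← C_mul]
    rw [← Finset.sum_mul, ← map_sum, sum_pow_perm₂ hz, map_zero, zero_mul]
  · rw [← homogPart_mul 2 1, ← homogPart_mul 1 1, hS, Submodule.span_mul_span,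
      Submodule.span_mul_span, Submodule.span_le]
    rintro _ ⟨_, ⟨_, ⟨a, rfl⟩, _, ⟨b, rfl⟩, rfl⟩, _, ⟨d, rfl⟩, rfl⟩
    refine key _ ?_
    simp only [coordAct_coord, inv_inv, evalLine_coord, map_mul, mul_mul_mul_comm _ X _ X,
      mul_mul_mul_comm _ (X * X) _ X]
    simp only [← C_mul]
    rw [← Finset.sum_mul, ← map_sum, sum_pow_perm₃ hz, map_zero, zero_mul]

theorem X_pow_four_dvd_evalLine (hG : (Fintype.card (alternatingGroup (Fin 4)) : F) ≠ 0)
    (hz : z ^ 2 = -1) {s : CoordRing F (Fin 4 → F)}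
    (hs : s ∈ positivePart (homogPart F (Fin 4 → F)) (invariantRing (permRep F)).toSubmodule) :
    X ^ 4 ∣ evalLine F z s := by
  rw [positivePart_eq _ hG] at hs
  suffices h : ⨆ (d : ℕ) (_ : 1 ≤ d), invPart (permRep F) d ≤
      ((Ideal.span {(X ^ 4 : K[X])}).restrictScalars F).comap (evalLine F z).toLinearMap from
    Ideal.mem_span_singleton.mp (h hs)
  refine iSup₂_le fun d hd s hs => Ideal.mem_span_singleton.mpr ?_
  rcases le_or_gt d 3 with hd' | hd'
  · have := evalLine_reynolds_eq_zero F hz hd hd' hs.2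
    rw [LinearMap.mem_ker, LinearMap.comp_apply, reynolds_of_mem _ hG hs.1] at this
    rw [this]
    exact dvd_zero _
  · obtain ⟨r, hr⟩ := exists_evalLine_eq F z hs.2
    rw [AlgHom.toLinearMap_apply, hr]
    exact (pow_dvd_pow X hd').mul_left _

theorem X_pow_dvd_evalLine (hG : (Fintype.card (alternatingGroup (Fin 4)) : F) ≠ 0)
    (hz : z ^ 2 = -1) {s : CoordRing F (Fin 4 → F)} {k : ℕ}
    (hs : s ∈
      positivePart (homogPart F (Fin 4 → F)) (invariantRing (permRep F)).toSubmodule ^ k) :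
    X ^ (4 * k) ∣ evalLine F z s := by
  induction k generalizing s with
  | zero => simp
  | succ k ih =>
    rw [pow_succ] at hs
    rw [mul_add, mul_one, pow_add]
    induction hs using Submodule.mul_induction_on' with
    | mem_mul_mem a ha b hb =>
      rw [map_mul]
      exact mul_dvd_mul (ih ha) (X_pow_four_dvd_evalLine F hG hz hb)
    | add a _ b _ ha hb =>
      rw [map_add]
      exact dvd_add ha hb

/-- At the point, e₄ is z⁶ = -1 and Δ is -16z, a square root of the discriminant -256 of T⁴ - 1. -/
theorem evalLine_coordProd_pow_mul_vandermonde (hz : z ^ 2 = -1) (n : ℕ) :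
    evalLine F z (coordProd F ^ n * vandermonde F) =
      C ((-1) ^ n * (-16 * z)) * X ^ (4 * n + 6) := by
  have h₁ : evalLine F z (coordProd F) = C (-1) * X ^ 4 := by
    have : (-1 : K) = z ^ 0 * z ^ 1 * z ^ 2 * z ^ 3 := by
      linear_combination (-z ^ 4 + z ^ 2 - 1) * hz
    rw [this]
    simp only [coordProd, map_mul, evalLine_coord, map_pow, Fin.val_zero, Fin.val_one,
      Fin.val_two, show ((3 : Fin 4) : ℕ) = 3 from rfl]
    ring
  have h₂ : evalLine F z (vandermonde F) = C (-16 * z) * X ^ 6 := by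
    have : -16 * z = (z ^ 0 - z ^ 1) * (z ^ 0 - z ^ 2) * (z ^ 0 - z ^ 3) * (z ^ 1 - z ^ 2) *
        (z ^ 1 - z ^ 3) * (z ^ 2 - z ^ 3) := by
      rw [show z ^ 3 = z ^ 2 * z by ring, hz]
      linear_combination (4 * z ^ 3 - 12 * z) * hz
    rw [this]
    simp only [vandermonde, map_mul, map_sub, evalLine_coord, map_pow, Fin.val_zero, Fin.val_one,
      Fin.val_two, show ((3 : Fin 4) : ℕ) = 3 from rfl]
    ring
  rw [map_mul, map_pow, h₁, h₂]
  simp only [C_mul, C_pow]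
  ring

end Evaluation

theorem homogPart_pow {V : Type u} [AddCommGroup V] [Module F V] (d n : ℕ) :
    homogPart F V d ^ n = homogPart F V (d * n) :=
  (pow_mul _ d n).symm

theorem le_genNoetherRep_permRep (h2 : (2 : F) ≠ 0) (h3 : (3 : F) ≠ 0) {k : ℕ} (hk : 1 ≤ k) :
    ((4 * k + 2 : ℕ) : ℕ∞) ≤ genNoetherRep (permRep F) k := by
  have hG := card_cast_ne_zero h2 h3
  obtain ⟨z, hz⟩ := IsAlgClosed.exists_pow_nat_eq (-1 : AlgebraicClosure F) (n := 2) (by norm_num)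
  refine le_iInf₂ fun s hs => Nat.cast_le.mpr ?_
  by_contra! hlt
  let R₁ := positivePart (homogPart F (Fin 4 → F)) (invariantRing (permRep F)).toSubmodule
  let φ : CoordRing F (Fin 4 → F) →ₗ[F] AlgebraicClosure F :=
    (Polynomial.lcoeff (AlgebraicClosure F) (4 * k + 2)).restrictScalars F ∘ₗ
      (evalLine F z).toLinearMap
  have hφ (f : CoordRing F (Fin 4 → F)) : φ f = (evalLine F z f).coeff (4 * k + 2) := rfl
  -- The test subspace is `I ⊓ ker φ`. Membership in `I` is what makes it stable: multiplying by
  -- R_+^k then gives divisibility by X^{4k+4}, so the coefficient of X^{4k+2} vanishes again.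
  let I : Submodule F (CoordRing F (Fin 4 → F)) :=
    ((Ideal.span {(Polynomial.X ^ 4 : Polynomial (AlgebraicClosure F))}).restrictScalars F).comap
      (evalLine F z).toLinearMap
  have hI (f : CoordRing F (Fin 4 → F)) : f ∈ I ↔ Polynomial.X ^ 4 ∣ evalLine F z f :=
    Ideal.mem_span_singleton
  have hle : R₁ ≤ I ⊓ LinearMap.ker φ := by
    refine hs _ (fun f hf => ⟨(hI f).mpr (X_pow_four_dvd_evalLine F hG hz hf.1), ?_⟩) ?_
    · refine (iSup₂_le fun d hd f hf => ?_ : _ ≤ LinearMap.ker φ) hf.2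
      obtain ⟨r, hr⟩ := exists_evalLine_eq F z hf
      rw [LinearMap.mem_ker, hφ, hr, Polynomial.coeff_C_mul_X_pow, if_neg (by omega)]
    · rw [Submodule.mul_le]
      rintro f hf g ⟨hg, -⟩
      rw [SetLike.mem_coe, hI] at hg
      have hdvd := mul_dvd_mul (X_pow_dvd_evalLine F hG hz hf) hg
      rw [← map_mul] at hdvd
      refine ⟨(hI _).mpr ((dvd_mul_left _ _).trans hdvd), ?_⟩
      rw [← pow_add, Polynomial.X_pow_dvd_iff] at hdvd
      exact hdvd _ (by omega)
  -- Here n = k - 1, so the witness has degree 4n + 6 = 4k + 2.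
  obtain ⟨n, rfl⟩ := Nat.exists_eq_add_of_le' hk
  have hmem : coordProd F ^ n * vandermonde F ∈ R₁ := by
    obtain ⟨hc, hc'⟩ := coordProd_mem F
    obtain ⟨hv, hv'⟩ := vandermonde_mem F
    refine ⟨(invariantRing (permRep F)).mul_mem ((invariantRing (permRep F)).pow_mem hc n) hv, ?_⟩
    refine Submodule.mem_iSup_of_mem (4 * n + 6) (Submodule.mem_iSup_of_mem (by omega) ?_)
    rw [← homogPart_mul, ← homogPart_pow]
    exact Submodule.mul_mem_mul (Submodule.pow_mem_pow _ hc' n) hv'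
  have h0 := (hle hmem).2
  rw [SetLike.mem_coe, LinearMap.mem_ker, hφ, evalLine_coordProd_pow_mul_vandermonde F hz,
    Polynomial.coeff_C_mul_X_pow, if_pos (by ring)] at h0
  have h2' : (2 : AlgebraicClosure F) ≠ 0 := by
    rw [← map_ofNat (algebraMap F (AlgebraicClosure F)) 2]
    exact (map_ne_zero _).mpr h2
  have hz0 : z ≠ 0 := by
    rintro rfl
    norm_num at hz
  rw [show (-16 : AlgebraicClosure F) = -(2 * 2 * 2 * 2) by norm_num] at h0
  simp [h2', hz0] at h0

end AlternatingFour

end NoetherNumber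

theorem theorem3p3 (F : Type u) [Field F] (h2 : ringChar F ≠ 2) (h3 : ringChar F ≠ 3) :
    (∀ k : ℕ, 1 ≤ k →
      NoetherNumber.genNoetherNumber F (alternatingGroup (Fin 4)) k = ((4 * k + 2 : ℕ) : ℕ∞)) ∧
    NoetherNumber.noetherNumber F (alternatingGroup (Fin 4)) = 6 := by
  have two : (2 : F) ≠ 0 := fun h => by
    rcases (Nat.dvd_prime Nat.prime_two).mp (ringChar.dvd (by exact_mod_cast h)) with h' | h'
    · exact CharP.ringChar_ne_one h'
    · exact h2 h'
  have three : (3 : F) ≠ 0 := fun h => by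
    rcases (Nat.dvd_prime Nat.prime_three).mp (ringChar.dvd (by exact_mod_cast h)) with h' | h'
    · exact CharP.ringChar_ne_one h'
    · exact h3 h'
  have hG : (Fintype.card (alternatingGroup (Fin 4)) : F) ≠ 0 :=
    NoetherNumber.AlternatingFour.card_cast_ne_zero two three
  have gen (k : ℕ) (hk : 1 ≤ k) :
      NoetherNumber.genNoetherNumber F (alternatingGroup (Fin 4)) k = ((4 * k + 2 : ℕ) : ℕ∞) := by
    refine le_antisymm ?_ ?_
    · exact iSup_le fun V => iSup_le fun _ => iSup_le fun _ => iSup_le fun _ => iSup_le fun ρ =>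
        NoetherNumber.AlternatingFour.genNoetherRep_le ρ two three hk
    · exact le_iSup_of_le (Fin 4 → F) (le_iSup_of_le _ (le_iSup_of_le _ (le_iSup_of_le
        inferInstance (le_iSup_of_le (NoetherNumber.AlternatingFour.permRep F)
          (NoetherNumber.AlternatingFour.le_genNoetherRep_permRep F two three hk)))))
  refine ⟨gen, ?_⟩
  have h := gen 1 le_rfl
  simp only [NoetherNumber.genNoetherNumber, NoetherNumber.genNoetherRep_one _ hG] at h
  exact h
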